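/- Let $d\ge 3$, let $V\not\equiv 0$ (i.e. $V$ is not a.e. zero) be a nonnegative locally integrable function on $\mathbb R^d$ belonging to the reverse Hölder class $RH_s(\mathbb R^d)$ for some $s\in[d/2,\infty]$, that is, for some constant $C>0$, $\big(\frac1{|B|}\int_B V^s\big)^{1/s}\le C\,\frac1{|B|}\int_B V$ for all balls $B$ (with the essential supremum of $V$ over $B$ on the left when $s=\infty$). Let $$\rho(x):=\sup\Big\{r>0:\frac1{r^{d-2}}\int_{B(x,r)}V(y)\,dy\le 1\Big\}$$ be the critical radius function of $V$. For $\beta\in(0,1)$ and $\theta>0$, $\mathcal C^{\beta,*}_{\rho,\theta}(\mathbb R^d)$ is the set of real-valued $f\in L^1_{\rm loc}(\mathbb R^d)$ with $$\|f\|_{\mathcal C^{\beta,*}_{\rho,\theta}}:=\sup_{B=B(x_0,r)}\Big(1+\frac r{\rho(x_0)}\Big)^{-\theta}\frac1{|B|^{1+\beta/d}}\int_B\Big[f(x)-\operatorname*{ess\,inf}_{y\in B}f(y)\Big]dx<\infty .$$ A weight is a nonnegative locally integrable function that is not a.e. zero; for $1\le p<q<\infty$ and $\theta>0$, a weight $\omega$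 belongs to $A^{\rho,\theta}_{p,q}(\mathbb R^d)$ if $$[\omega]_{A^{\rho,\theta}_{p,q}}:=\sup_{B=B(x_0,r)}\Big(1+\frac r{\rho(x_0)}\Big)^{-\theta}\Big(\frac1{|B|}\int_B\omega^q\Big)^{1/q}\Big(\frac1{|B|}\int_B\omega^{-p'}\Big)^{1/p'}<\infty,\qquad p'=\frac p{p-1},$$ where for $p=1$ the last factor is replaced by $\big(\operatorname{ess\,inf}_B\omega\big)^{-1}$. Write $\omega^q(B):=\int_B\omega^q$. There are constants $C_0\ge1$ and $N_0>0$ such that $$\frac1{C_0}\Big(1+\frac{|x-y|}{\rho(x)}\Big)^{-N_0}\le\frac{\rho(y)}{\rho(x)}\le C_0\Big(1+\frac{|x-y|}{\rho(x)}\Big)^{\frac{N_0}{N_0+1}}\qquad(x,y\in\mathbb R^d).\tag{$*$}$$ Let $1\le p<q<\infty$, $0<\theta_1,\theta_2<\infty$ and $0<\beta<1$. (1) For every $N_0>0$ for which $(*)$ holds with some $C_0\geq 1$, there is a constant $C>0$, independent of $\omega$, $f$ and the ball, such that for all $\omega\in A^{\rho,\theta_2}_{p,q}(\mathbb R^d)$,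 all $f\in\mathcal C^{\beta,*}_{\rho,\theta_1}(\mathbb R^d)$ and all balls $B=B(x_0,r)$, $$\frac1{|B|^{\beta/d}}\Big(\frac1{\omega^q(B)}\int_B\Big[f(x)-\operatorname*{ess\,inf}_{y\in B}f(y)\Big]^q\omega(x)^q\,dx\Big)^{1/q}\le C\,[\omega]_{A^{\rho,\theta_2}_{p,q}}\Big(1+\frac r{\rho(x_0)}\Big)^{(N_0+1)\theta_1}\|f\|_{\mathcal C^{\beta,*}_{\rho,\theta_1}}.$$ (2) Conversely, let $\omega\in A^{\rho,\theta_2}_{p,q}(\mathbb R^d)$, let $f$ be a real-valued measurable function and let $C>0$ be such that for all balls $B=B(x_0,r)$, $$\frac1{|B|^{\beta/d}}\Big(\frac1{\omega^q(B)}\int_B\Big[f(x)-\operatorname*{ess\,inf}_{y\in B}f(y)\Big]^q\omega(x)^q\,dx\Big)^{1/q}\le C\,[\omega]_{A^{\rho,\theta_2}_{p,q}}\Big(1+\frac r{\rho(x_0)}\Big)^{\theta_1-\theta_2}.$$ Then $f\in\mathcal C^{\beta,*}_{\rho,\theta_1}(\mathbb R^d)$ and $\|f\|_{\mathcal C^{\beta,*}_{\rho,\theta_1}}\le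 C\,[\omega]_{A^{\rho,\theta_2}_{p,q}}^2$. -/

import Mathlib

open MeasureTheory
open scoped ENNReal

noncomputable section

/-- The reverse Hölder class `RH_s`, `1 < s ≤ ∞`: the normalised `L^s` norm of `V` over every ball
(the essential supremum when `s = ∞`) is at most a constant times the mean value of `V` over
the ball. -/
def ReverseHolder {d : ℕ} (V : EuclideanSpace ℝ (Fin d) → ℝ) (s : ℝ≥0∞) : Prop :=
  ∃ C : ℝ, 0 < C ∧ ∀ (x₀ : EuclideanSpace ℝ (Fin d)) (r : ℝ), 0 < r →
    eLpNorm V s ((volume (Metric.ball x₀ r))⁻¹ • volume.restrict (Metric.ball x₀ r)) ≤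
      ENNReal.ofReal C *
        ((volume (Metric.ball x₀ r))⁻¹ * ∫⁻ y in Metric.ball x₀ r, ENNReal.ofReal (V y))

/-- The critical radius function of the potential `V`:
`ρ(x) = sup {r > 0 : r^{-(d-2)} ∫_{B(x,r)} V ≤ 1}`. -/
def criticalRadius {d : ℕ} (V : EuclideanSpace ℝ (Fin d) → ℝ)
    (x : EuclideanSpace ℝ (Fin d)) : ℝ :=
  sSup {r : ℝ | 0 < r ∧ 1 / r ^ ((d : ℤ) - 2) * ∫ y in Metric.ball x r, V y ≤ 1}

/-- `N₀` is an exponent in the slow-variation inequality of `ρ`: for some constant `C₀ ≥ 1`,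
`C₀⁻¹ (1 + |x-y|/ρ(x))^{-N₀} ≤ ρ(y)/ρ(x) ≤ C₀ (1 + |x-y|/ρ(x))^{N₀/(N₀+1)}` for all `x, y`. -/
def IsSlowVariationExponent {d : ℕ} (ρ : EuclideanSpace ℝ (Fin d) → ℝ) (N₀ : ℝ) : Prop :=
  0 < N₀ ∧ ∃ C₀ : ℝ, 1 ≤ C₀ ∧ ∀ x y : EuclideanSpace ℝ (Fin d),
    1 / C₀ * (1 + dist x y / ρ x) ^ (-N₀) ≤ ρ y / ρ x ∧
      ρ y / ρ x ≤ C₀ * (1 + dist x y / ρ x) ^ (N₀ / (N₀ + 1))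

/-- The growth factor `(1 + r/ρ(x₀))^θ`, as an extended nonnegative real. -/
def growthFactor {d : ℕ} (ρ : EuclideanSpace ℝ (Fin d) → ℝ)
    (x₀ : EuclideanSpace ℝ (Fin d)) (r θ : ℝ) : ℝ≥0∞ :=
  ENNReal.ofReal ((1 + r / ρ x₀) ^ θ)

/-- `f(x) - ess inf_{y ∈ B(x₀,r)} f(y)`. The essential infimum is an extended real number, so this
is `∞` when `f` is not essentially bounded below on the ball; it is nonnegative for almost every
`x` in the ball. -/
def lowerOsc {d : ℕ} (f : EuclideanSpace ℝ (Fin d) → ℝ)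
    (x₀ : EuclideanSpace ℝ (Fin d)) (r : ℝ) (x : EuclideanSpace ℝ (Fin d)) : ℝ≥0∞ :=
  ((f x : EReal) -
    essInf (fun y => (f y : EReal)) (volume.restrict (Metric.ball x₀ r))).toENNReal

/-- The `C^{β,*}_{ρ,θ}`-constant of `f`, a supremum over all balls. -/
def campanatoLowerConst {d : ℕ} (ρ : EuclideanSpace ℝ (Fin d) → ℝ) (β θ : ℝ)
    (f : EuclideanSpace ℝ (Fin d) → ℝ) : ℝ≥0∞ :=
  ⨆ (x₀ : EuclideanSpace ℝ (Fin d)) (r : ℝ) (_ : 0 < r),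
    growthFactor ρ x₀ r (-θ) *
      ((volume (Metric.ball x₀ r) ^ (1 + β / (d : ℝ)))⁻¹ *
        ∫⁻ x in Metric.ball x₀ r, lowerOsc f x₀ r x)

/-- Membership in `C^{β,*}_{ρ,θ}(ℝ^d)`. -/
def MemCampanatoLower {d : ℕ} (ρ : EuclideanSpace ℝ (Fin d) → ℝ) (β θ : ℝ)
    (f : EuclideanSpace ℝ (Fin d) → ℝ) : Prop :=
  LocallyIntegrable f volume ∧ campanatoLowerConst ρ β θ f < ∞

/-- A weight: a nonnegative locally integrable function, not almost everywhere zero. -/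
structure IsWeight {d : ℕ} (ω : EuclideanSpace ℝ (Fin d) → ℝ) : Prop where
  nonneg : ∀ x, 0 ≤ ω x
  locallyIntegrable : LocallyIntegrable ω volume
  not_ae_zero : ¬ ω =ᵐ[volume] 0

/-- `ω^q(B) = ∫_B ω(x)^q dx`. -/
def weightMass {d : ℕ} (ω : EuclideanSpace ℝ (Fin d) → ℝ) (q : ℝ)
    (B : Set (EuclideanSpace ℝ (Fin d))) : ℝ≥0∞ :=
  ∫⁻ x in B, ENNReal.ofReal (ω x) ^ q

/-- The `A^{ρ,θ}_{p,q}` characteristic constant `[ω]` of `ω`, a supremum over all balls. Negative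
powers are taken in `[0,∞]`, so that `0^{-p'} = ∞`. -/
def apqConst {d : ℕ} (ρ : EuclideanSpace ℝ (Fin d) → ℝ) (p q θ : ℝ)
    (ω : EuclideanSpace ℝ (Fin d) → ℝ) : ℝ≥0∞ :=
  ⨆ (x₀ : EuclideanSpace ℝ (Fin d)) (r : ℝ) (_ : 0 < r),
    growthFactor ρ x₀ r (-θ) *
      ((volume (Metric.ball x₀ r))⁻¹ * weightMass ω q (Metric.ball x₀ r)) ^ (1 / q) *
        (if p = 1 then
          (essInf (fun x => ENNReal.ofReal (ω x)) (volume.restrict (Metric.ball x₀ r)))⁻¹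
        else
          ((volume (Metric.ball x₀ r))⁻¹ *
            ∫⁻ x in Metric.ball x₀ r, ENNReal.ofReal (ω x) ^ (-(p / (p - 1)))) ^
              (1 / (p / (p - 1))))

/-- Membership in the weight class `A^{ρ,θ}_{p,q}(ℝ^d)`. -/
def MemApq {d : ℕ} (ρ : EuclideanSpace ℝ (Fin d) → ℝ) (p q θ : ℝ)
    (ω : EuclideanSpace ℝ (Fin d) → ℝ) : Prop :=
  IsWeight ω ∧ apqConst ρ p q θ ω < ∞

/-- The weighted oscillation
`|B|^{-β/d} (ω^q(B)⁻¹ ∫_B [f - ess inf_B f]^q ω^q)^{1/q}` over the ball `B = B(x₀,r)`. -/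
def weightedOsc {d : ℕ} (ω : EuclideanSpace ℝ (Fin d) → ℝ) (q β : ℝ)
    (f : EuclideanSpace ℝ (Fin d) → ℝ) (x₀ : EuclideanSpace ℝ (Fin d)) (r : ℝ) : ℝ≥0∞ :=
  (volume (Metric.ball x₀ r) ^ (β / (d : ℝ)))⁻¹ *
    ((weightMass ω q (Metric.ball x₀ r))⁻¹ *
      ∫⁻ x in Metric.ball x₀ r, lowerOsc f x₀ r x ^ q * ENNReal.ofReal (ω x) ^ q) ^ (1 / q)

end

/-! Slow variation of `ρ`. Let `ψ x r` be the normalised mass of `V` whose sublevel set `{ψ ≤ 1}`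
defines `ρ`. Hölder's inequality in one direction and the reverse Hölder inequality at exponent
`d/2` in the other make `ψ x r` comparable to `N x r ^ (2/d)`, where `N` is the integral of
`V^{d/2}` over the ball. That exponent is the scale-invariant one: the normalisation disappears and
`N` is monotone in the ball. Doubling of the mass of `V` bounds the growth of `ψ` from above by a
power `κ`; it also makes `N` doubling, hence reverse doubling, which bounds the growth of `ψ` from
below by a power `δ`. Comparing the two powers yields slow variation with exponent `κ/δ`
(`isSlowVariationExponent_sSup`).

Claim (1) is a pointwise statement in which the weight plays no role. At a Lebesgue point, the
averages of `f` over balls shrinking by halves tend to `f x`, each exceeds the essential infimum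
over its ball by a geometrically small amount, and the infima themselves rise by geometrically small
amounts. Summing gives a Hölder-type bound for `f - ess inf f` (`MemCampanatoLower.ae_sub_le`,
`MemCampanatoLower.ae_lowerOsc_le`). A pointwise bound passes through any weighted mean, and the
factor `[ω]` is harmless because it is at least `1` (`MemApq.one_le_apqConst`).

Claim (2) is Hölder's inequality: the unweighted mean is at most the weighted `L^q` mean times a
product controlled by `[ω]` (`MemApq.mean_le`). One power of `[ω]` comes from the hypothesis and the
other from this product. -/

/-! ### Polynomial growth from doubling and reverse doubling. -/

theorem rpow_logb_comm {lam a b : ℝ} (ha : 0 < a) (hb : 0 < b) :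
    a ^ Real.logb lam b = b ^ Real.logb lam a := by
  rw [Real.rpow_def_of_pos ha, Real.rpow_def_of_pos hb, Real.logb, Real.logb]
  congr 1
  ring

/-- A monotone doubling function grows at most polynomially. -/
theorem le_rpow_of_doubling {g : ℝ → ℝ} {lam D : ℝ} (hlam : 1 < lam) (hD : 1 ≤ D)
    (hmono : ∀ r R, 0 < r → r ≤ R → g r ≤ g R) (hg : ∀ r, 0 < r → 0 ≤ g r)
    (h : ∀ r, 0 < r → g (lam * r) ≤ D * g r) {r R : ℝ} (hr : 0 < r) (hrR : r ≤ R) :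
    g R ≤ D * (R / r) ^ Real.logb lam D * g r := by
  have hlam0 : 0 < lam := one_pos.trans hlam
  have hD0 : 0 < D := one_pos.trans_le hD
  have iter : ∀ n : ℕ, g (lam ^ n * r) ≤ D ^ n * g r := by
    intro n
    induction n with
    | zero => simp
    | succ n ih =>
      calc g (lam ^ (n + 1) * r) = g (lam * (lam ^ n * r)) := by ring_nf
        _ ≤ D * g (lam ^ n * r) := h _ (by positivity)
        _ ≤ D * (D ^ n * g r) := by gcongr
        _ = D ^ (n + 1) * g r := by ring
  have hq : 1 ≤ R / r := (one_le_div hr).2 hrR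
  have hq0 : 0 < R / r := one_pos.trans_le hq
  -- `t` is the exact number of dilations from `r` to `R`. Rounding it up costs at most one factor
  -- `D`, the leading constant, and `D ^ t` is a power of `R / r` by `rpow_logb_comm`.
  set t := Real.logb lam (R / r) with ht
  have ht0 : 0 ≤ t := Real.logb_nonneg hlam hq
  have hR : R ≤ lam ^ ⌈t⌉₊ * r := by
    rw [← div_le_iff₀ hr, ← Real.rpow_natCast, ← Real.logb_le_iff_le_rpow hlam hq0]
    exact Nat.le_ceil t
  calc g R ≤ g (lam ^ ⌈t⌉₊ * r) := hmono _ _ (hr.trans_le hrR) hR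
    _ ≤ D ^ ⌈t⌉₊ * g r := iter _
    _ ≤ D * (R / r) ^ Real.logb lam D * g r := by
      gcongr
      · exact hg r hr
      · rw [rpow_logb_comm hq0 hD0, ← ht, ← Real.rpow_natCast]
        nth_rw 2 [← Real.rpow_one D]
        rw [← Real.rpow_add hD0]
        apply Real.rpow_le_rpow_of_exponent_le hD
        linarith [Nat.ceil_lt_add_one ht0]

/-- A monotone reverse doubling function grows at least polynomially. -/
theorem le_rpow_of_reverse_doubling {g : ℝ → ℝ} {lam K : ℝ} (hlam : 1 < lam) (hK : 1 ≤ K)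
    (hmono : ∀ r R, 0 < r → r ≤ R → g r ≤ g R) (hg : ∀ r, 0 < r → 0 ≤ g r)
    (h : ∀ r, 0 < r → K * g r ≤ g (lam * r)) {r R : ℝ} (hr : 0 < r) (hrR : r ≤ R) :
    g r ≤ K * (r / R) ^ Real.logb lam K * g R := by
  have hlam0 : 0 < lam := one_pos.trans hlam
  have hK0 : 0 < K := one_pos.trans_le hK
  have iter : ∀ n : ℕ, K ^ n * g r ≤ g (lam ^ n * r) := by
    intro n
    induction n with
    | zero => simp
    | succ n ih =>
      calc K ^ (n + 1) * g r = K * (K ^ n * g r) := by ring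
        _ ≤ K * g (lam ^ n * r) := by gcongr
        _ ≤ g (lam * (lam ^ n * r)) := h _ (by positivity)
        _ = g (lam ^ (n + 1) * r) := by ring_nf
  have hR0 : 0 < R := hr.trans_le hrR
  have hq : 1 ≤ R / r := (one_le_div hr).2 hrR
  have hq0 : 0 < R / r := one_pos.trans_le hq
  set t := Real.logb lam (R / r) with ht
  have ht0 : 0 ≤ t := Real.logb_nonneg hlam hq
  have hR : lam ^ ⌊t⌋₊ * r ≤ R := by
    rw [← le_div_iff₀ hr, ← Real.rpow_natCast, ← Real.le_logb_iff_rpow_le hlam hq0]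
    exact Nat.floor_le ht0
  have h1 : K ^ ⌊t⌋₊ * g r ≤ g R := (iter _).trans (hmono _ _ (by positivity) hR)
  have h2 : (R / r) ^ Real.logb lam K ≤ K * K ^ ⌊t⌋₊ := by
    rw [rpow_logb_comm hq0 hK0, ← ht, ← Real.rpow_natCast]
    nth_rw 2 [← Real.rpow_one K]
    rw [← Real.rpow_add hK0]
    apply Real.rpow_le_rpow_of_exponent_le hK
    linarith [Nat.lt_floor_add_one t]
  have h3 : (r / R) ^ Real.logb lam K = ((R / r) ^ Real.logb lam K)⁻¹ := by
    rw [← Real.inv_rpow hq0.le, inv_div]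
  have h4 : 0 < (R / r) ^ Real.logb lam K := by positivity
  rw [h3, mul_assoc, mul_comm, mul_assoc, inv_mul_eq_div, le_div_iff₀ h4]
  calc g r * (R / r) ^ Real.logb lam K ≤ g r * (K * K ^ ⌊t⌋₊) := by
        gcongr
        exact hg r hr
    _ = K * (K ^ ⌊t⌋₊ * g r) := by ring
    _ ≤ K * g R := by gcongr
    _ = g R * K := mul_comm _ _

/-! ### Slow variation of the critical radius from two-sided growth of `ψ`. -/

section
variable {d : ℕ} {ψ : EuclideanSpace ℝ (Fin d) → ℝ → ℝ} {C₁ C₂ C₃ δ κ : ℝ}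

/-- The lower growth bound forces `ψ x r → 0` as `r → 0` and `ψ x r → ∞` as `r → ∞`, so the sublevel
set is nonempty and bounded. No continuity of `ψ` is available, so the value at the supremum is
compared with a member of the set larger than half the supremum; this is the source of `2 ^ κ`. -/
theorem sSup_sublevel_pos_and_le (hδ : 0 < δ) (hκ : 0 < κ) (hC₁ : 0 < C₁) (hC₂ : 0 < C₂)
    (hpos : ∀ x r, 0 < r → 0 < ψ x r)
    (hlow : ∀ x r R, 0 < r → r ≤ R → ψ x r ≤ C₁ * (r / R) ^ δ * ψ x R)
    (hup : ∀ x r R, 0 < r → r ≤ R → ψ x R ≤ C₂ * (R / r) ^ κ * ψ x r)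
    (x : EuclideanSpace ℝ (Fin d)) :
    BddAbove {r : ℝ | 0 < r ∧ ψ x r ≤ 1} ∧ 0 < sSup {r : ℝ | 0 < r ∧ ψ x r ≤ 1} ∧
      ψ x (sSup {r : ℝ | 0 < r ∧ ψ x r ≤ 1}) ≤ C₂ * 2 ^ κ := by
  set S := {r : ℝ | 0 < r ∧ ψ x r ≤ 1} with hS
  have h1 := hpos x 1 one_pos
  have hbdd : BddAbove S := by
    refine ⟨max 1 ((C₁ / ψ x 1) ^ δ⁻¹), ?_⟩
    rintro r ⟨hr, hψ⟩
    by_contra! hlt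
    rw [max_lt_iff] at hlt
    have h2 := hlow x 1 r one_pos hlt.1.le
    have h3 : C₁ / ψ x 1 < r ^ δ := by
      have := Real.rpow_lt_rpow (by positivity) hlt.2 hδ
      rwa [← Real.rpow_mul (by positivity), inv_mul_cancel₀ hδ.ne', Real.rpow_one] at this
    have h4 : ψ x 1 ≤ C₁ * (1 / r) ^ δ := h2.trans (mul_le_of_le_one_right (by positivity) hψ)
    rw [one_div, Real.inv_rpow hr.le, ← div_eq_mul_inv, le_div_iff₀ (by positivity)] at h4
    rw [div_lt_iff₀ h1] at h3
    linarith
  have hne : ∃ r, r ∈ S := by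
    set K := C₁ * ψ x 1 with hK
    have hK0 : 0 < K := by positivity
    set r := min 1 ((K⁻¹) ^ δ⁻¹) with hr
    have hr0 : 0 < r := by positivity
    refine ⟨r, hr0, ?_⟩
    have h2 := hlow x r 1 hr0 (min_le_left _ _)
    have h3 : r ^ δ ≤ K⁻¹ := by
      have := Real.rpow_le_rpow hr0.le (min_le_right 1 ((K⁻¹) ^ δ⁻¹)) hδ.le
      rwa [← Real.rpow_mul (by positivity), inv_mul_cancel₀ hδ.ne', Real.rpow_one] at this
    calc ψ x r ≤ C₁ * (r / 1) ^ δ * ψ x 1 := h2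
      _ = K * r ^ δ := by rw [div_one]; ring
      _ ≤ K * K⁻¹ := by gcongr
      _ = 1 := mul_inv_cancel₀ hK0.ne'
  obtain ⟨r₁, hr₁⟩ := hne
  have hsup : 0 < sSup S := hr₁.1.trans_le (le_csSup hbdd hr₁)
  refine ⟨hbdd, hsup, ?_⟩
  obtain ⟨r, hr, hlt⟩ := exists_lt_of_lt_csSup ⟨r₁, hr₁⟩ (half_lt_self hsup)
  have hr0 : 0 < r := hr.1
  calc ψ x (sSup S) ≤ C₂ * (sSup S / r) ^ κ * ψ x r := hup x r _ hr0 (le_csSup hbdd hr)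
    _ ≤ C₂ * (sSup S / r) ^ κ * 1 := by gcongr; exact hr.2
    _ ≤ C₂ * 2 ^ κ := by
      rw [mul_one]
      gcongr
      rw [div_le_iff₀ hr0]
      linarith

/-- Two-sided polynomial growth of `ψ` makes `x ↦ sup {r | ψ x r ≤ 1}` slowly varying. -/
theorem isSlowVariationExponent_sSup (hδ : 0 < δ) (hκ : 0 < κ) (hC₁ : 0 < C₁) (hC₂ : 0 < C₂)
    (hC₃ : 0 < C₃) (hpos : ∀ x r, 0 < r → 0 < ψ x r)
    (hlow : ∀ x r R, 0 < r → r ≤ R → ψ x r ≤ C₁ * (r / R) ^ δ * ψ x R)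
    (hup : ∀ x r R, 0 < r → r ≤ R → ψ x R ≤ C₂ * (R / r) ^ κ * ψ x r)
    (hmove : ∀ x y R, 0 < R → dist x y ≤ R → ψ y R ≤ C₃ * ψ x (2 * R)) :
    IsSlowVariationExponent (fun x => sSup {r : ℝ | 0 < r ∧ ψ x r ≤ 1}) (κ / δ) := by
  set ρ : EuclideanSpace ℝ (Fin d) → ℝ := fun x => sSup {r : ℝ | 0 < r ∧ ψ x r ≤ 1} with hρ
  have hfacts := sSup_sublevel_pos_and_le hδ hκ hC₁ hC₂ hpos hlow hup
  have hρ0 : ∀ x, 0 < ρ x := fun x => (hfacts x).2.1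
  have hρψ : ∀ x, ψ x (ρ x) ≤ C₂ * 2 ^ κ := fun x => (hfacts x).2.2
  set N := κ / δ with hN
  have hN0 : 0 < N := by positivity
  set K := C₁ * C₃ * C₂ * 2 ^ κ * (C₂ * 2 ^ κ) with hK
  have hK0 : 0 < K := by positivity
  -- `K` collects the constants of the chain of estimates for `ψ y r` below, and `c` is small enough
  -- that `K * c ^ δ ≤ 1`. The bound `c ≤ 1` keeps the test radius below `R + t`.
  set c := min 1 ((K⁻¹) ^ δ⁻¹) with hc
  have hc0 : 0 < c := by positivity
  have hc1 : c ≤ 1 := min_le_left _ _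
  have hcK : K * c ^ δ ≤ 1 := by
    have := Real.rpow_le_rpow hc0.le (min_le_right 1 ((K⁻¹) ^ δ⁻¹)) hδ.le
    rw [← Real.rpow_mul (by positivity), inv_mul_cancel₀ hδ.ne', Real.rpow_one] at this
    calc K * c ^ δ ≤ K * K⁻¹ := by gcongr
      _ = 1 := mul_inv_cancel₀ hK0.ne'
  have key : ∀ x y, c * ρ x * (1 + dist x y / ρ x) ^ (-N) ≤ ρ y := by
    intro x y
    have hR := hρ0 x
    set R := ρ x with hRdef
    set t := dist x y with ht
    have ht0 : 0 ≤ t := dist_nonneg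
    set u := 1 + t / R with hu
    have hu1 : 1 ≤ u := le_add_of_nonneg_right (by positivity)
    have hu0 : 0 < u := one_pos.trans_le hu1
    have hRt : R + t = R * u := by rw [hu]; field_simp
    have huN : u ^ (-N) ≤ 1 := Real.rpow_le_one_of_one_le_of_nonpos hu1 (by linarith)
    -- Test radius for `ρ y`. Shrinking from `R + t` to `r` gains `(u ^ (-N)) ^ δ`, while recentring
    -- at `x` and returning to radius `R` loses `u ^ κ`. These cancel exactly when `N = κ / δ`.
    set r := c * u ^ (-N) * (R + t) with hr
    have hr0 : 0 < r := by positivity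
    have hrle : r ≤ R + t :=
      mul_le_of_le_one_left (by positivity) (mul_le_one₀ hc1 (by positivity) huN)
    have hRt0 : 0 < R + t := by positivity
    have hmem : ψ y r ≤ 1 := by
      calc ψ y r ≤ C₁ * (r / (R + t)) ^ δ * ψ y (R + t) := hlow y r _ hr0 hrle
        _ ≤ C₁ * (r / (R + t)) ^ δ * (C₃ * ψ x (2 * (R + t))) := by
          gcongr
          exact hmove x y _ hRt0 (by linarith)
        _ ≤ C₁ * (r / (R + t)) ^ δ * (C₃ * (C₂ * (2 * (R + t) / R) ^ κ * ψ x R)) := by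
          gcongr
          exact hup x R _ hR (by linarith)
        _ ≤ C₁ * (r / (R + t)) ^ δ * (C₃ * (C₂ * (2 * (R + t) / R) ^ κ * (C₂ * 2 ^ κ))) := by
          gcongr
          exact hρψ x
        _ = K * c ^ δ := by
          have e1 : r / (R + t) = c * u ^ (-N) := by rw [hr]; field_simp
          have e2 : 2 * (R + t) / R = 2 * u := by rw [hRt]; field_simp
          have e3 : (u ^ (-N)) ^ δ * u ^ κ = 1 := by
            rw [← Real.rpow_mul hu0.le, ← Real.rpow_add hu0, hN]
            have : -(κ / δ) * δ + κ = 0 := by field_simp; ring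
            rw [this, Real.rpow_zero]
          rw [e1, e2, Real.mul_rpow hc0.le (by positivity), Real.mul_rpow (by norm_num) hu0.le, hK]
          linear_combination (C₁ * C₃ * C₂ * 2 ^ κ * (C₂ * 2 ^ κ) * c ^ δ) * e3
        _ ≤ 1 := hcK
    have h1 : r ≤ ρ y := le_csSup (hfacts y).1 ⟨hr0, hmem⟩
    refine le_trans ?_ h1
    rw [hr, show c * R * u ^ (-N) = c * u ^ (-N) * R by ring]
    gcongr
    linarith
  set E := N / (N + 1) with hE
  have hE0 : 0 < E := by positivity
  refine ⟨hN0, max c⁻¹ (max (c⁻¹ * 2 ^ N) ((c⁻¹ * 2 ^ N) ^ (1 / (N + 1)))),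
    le_max_of_le_left ((one_le_inv₀ hc0).2 hc1), fun x y => ⟨?_, ?_⟩⟩
  · rw [le_div_iff₀ (hρ0 x)]
    refine le_trans ?_ (key x y)
    have hbase : 0 < 1 + dist x y / ρ x := by
      have := hρ0 x
      positivity
    have : 1 / max c⁻¹ (max (c⁻¹ * 2 ^ N) ((c⁻¹ * 2 ^ N) ^ (1 / (N + 1)))) ≤ c := by
      rw [one_div]
      exact inv_le_of_inv_le₀ hc0 (le_max_left _ _)
    calc _ ≤ c * (1 + dist x y / ρ x) ^ (-N) * ρ x := by
          have := (hρ0 x).le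
          gcongr
      _ = _ := by ring
  · have hx := hρ0 x
    have hy := hρ0 y
    have hk := key y x
    rw [dist_comm y x] at hk
    set t := dist x y with ht
    have ht0 : 0 ≤ t := dist_nonneg
    -- The upper bound is `key` with `x` and `y` exchanged. If `t ≤ ρ y`, the base `1 + t / ρ y` is
    -- at most `2` and a constant suffices; otherwise it is at most `2 * t / ρ y`.
    rcases le_total t (ρ y) with hty | hty
    · have h1 : (2 : ℝ) ^ (-N) ≤ (1 + t / ρ y) ^ (-N) := by
        apply Real.rpow_le_rpow_of_nonpos (by positivity) _ (by linarith)
        have : t / ρ y ≤ 1 := (div_le_one hy).2 hty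
        linarith
      have h2 : c * ρ y * 2 ^ (-N) ≤ ρ x := le_trans (by gcongr) hk
      rw [Real.rpow_neg (by norm_num), ← div_eq_mul_inv, div_le_iff₀ (by positivity)] at h2
      have h3 : ρ y / ρ x ≤ c⁻¹ * 2 ^ N := by
        rw [div_le_iff₀ hx, inv_mul_eq_div, div_mul_eq_mul_div, le_div_iff₀ hc0]
        linarith
      refine h3.trans ?_
      rw [← mul_one (c⁻¹ * 2 ^ N)]
      apply mul_le_mul _ _ zero_le_one (by positivity)
      · rw [mul_one]
        exact (le_max_left _ _).trans (le_max_right _ _)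
      · exact Real.one_le_rpow (le_add_of_nonneg_right (by positivity)) hE0.le
    · have ht1 : 0 < t := hy.trans_le hty
      have h1 : (2 * t / ρ y) ^ (-N) ≤ (1 + t / ρ y) ^ (-N) := by
        apply Real.rpow_le_rpow_of_nonpos (by positivity) _ (by linarith)
        have : 1 ≤ t / ρ y := (one_le_div hy).2 hty
        rw [mul_div_assoc]
        linarith
      have h2 : c * ρ y * (2 * t / ρ y) ^ (-N) ≤ ρ x := le_trans (by gcongr) hk
      rw [Real.rpow_neg (by positivity), ← div_eq_mul_inv, div_le_iff₀ (by positivity)] at h2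
      -- Writing `t / ρ y` as `(t / ρ x) / (ρ y / ρ x)` makes the unknown ratio appear to the power
      -- `N + 1`; extracting that root produces the exponent `N / (N + 1)`.
      have h3 : (ρ y / ρ x) ^ (N + 1) ≤ c⁻¹ * 2 ^ N * (t / ρ x) ^ N := by
        rw [show 2 * t / ρ y = 2 * (t / ρ x) / (ρ y / ρ x) by field_simp,
          Real.div_rpow (by positivity) (by positivity),
          Real.mul_rpow (by norm_num) (by positivity)] at h2
        have hz : 0 < ρ y / ρ x := by positivity
        rw [Real.rpow_add hz, Real.rpow_one]
        have h4 : 0 < (ρ y / ρ x) ^ N := by positivity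
        rw [mul_div_assoc', le_div_iff₀ h4] at h2
        rw [mul_assoc, ← div_eq_inv_mul, le_div_iff₀ hc0,
          show (ρ y / ρ x) ^ N * (ρ y / ρ x) * c = (c * ρ y * (ρ y / ρ x) ^ N) / ρ x by
            field_simp, div_le_iff₀ hx]
        linarith
      have h5 : ρ y / ρ x ≤ (c⁻¹ * 2 ^ N) ^ (1 / (N + 1)) * (t / ρ x) ^ E := by
        have := Real.rpow_le_rpow (by positivity) h3 (z := 1 / (N + 1)) (by positivity)
        rw [← Real.rpow_mul (by positivity), mul_one_div_cancel (by positivity), Real.rpow_one,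
          Real.mul_rpow (by positivity) (by positivity), ← Real.rpow_mul (by positivity),
          mul_one_div] at this
        exact this
      refine h5.trans ?_
      gcongr
      · exact (le_max_right _ _).trans (le_max_right _ _)
      · linarith
end

/-! ### The potential: reverse Hölder, doubling and reverse doubling. -/

section
variable {d : ℕ} {V : EuclideanSpace ℝ (Fin d) → ℝ} {s : ℝ≥0∞}

theorem volume_ball_eq (hd : 3 ≤ d) (x : EuclideanSpace ℝ (Fin d)) {r : ℝ} (hr : 0 ≤ r) :
    volume (Metric.ball x r) =
      ENNReal.ofReal (r ^ d) * volume (Metric.ball (0 : EuclideanSpace ℝ (Fin d)) 1) := by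
  have : Nonempty (Fin d) := ⟨⟨0, by omega⟩⟩
  rw [Measure.addHaar_ball volume x hr, finrank_euclideanSpace_fin]

theorem volume_real_ball_eq (hd : 3 ≤ d) (x : EuclideanSpace ℝ (Fin d)) {r : ℝ} (hr : 0 ≤ r) :
    volume.real (Metric.ball x r) =
      r ^ d * volume.real (Metric.ball (0 : EuclideanSpace ℝ (Fin d)) 1) := by
  rw [measureReal_def, volume_ball_eq hd x hr, ENNReal.toReal_mul,
    ENNReal.toReal_ofReal (by positivity), measureReal_def]

theorem volume_ball_ne_zero (x : EuclideanSpace ℝ (Fin d)) {r : ℝ} (hr : 0 < r) :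
    volume (Metric.ball x r) ≠ 0 := (Metric.measure_ball_pos volume x hr).ne'

theorem integrableOn_ball_of_locallyIntegrable (hV : LocallyIntegrable V volume)
    (x : EuclideanSpace ℝ (Fin d)) (r : ℝ) : IntegrableOn V (Metric.ball x r) volume :=
  (hV.integrableOn_isCompact (isCompact_closedBall x r)).mono_set Metric.ball_subset_closedBall

/-- `RH_s` with `s ≥ d/2` is contained in `RH_{d/2}`. -/
theorem ReverseHolder.exists_half_dim (hd : 3 ≤ d) (hV0 : ∀ x, 0 ≤ V x)
    (hV : LocallyIntegrable V volume) (hs : (d : ℝ≥0∞) / 2 ≤ s) (h : ReverseHolder V s) :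
    ∃ C : ℝ, 0 < C ∧ ∀ (x : EuclideanSpace ℝ (Fin d)) (r : ℝ), 0 < r →
      ((volume (Metric.ball x r))⁻¹ *
          ∫⁻ y in Metric.ball x r, ENNReal.ofReal (V y) ^ ((d : ℝ) / 2)) ^ (2 / (d : ℝ)) ≤
        ENNReal.ofReal C *
          ((volume (Metric.ball x r))⁻¹ * ∫⁻ y in Metric.ball x r, ENNReal.ofReal (V y)) := by
  obtain ⟨C, hC, h⟩ := h
  refine ⟨C, hC, fun x r hr => ?_⟩
  refine le_trans ?_ (h x r hr)
  have hprob : IsProbabilityMeasure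
      ((volume (Metric.ball x r))⁻¹ • volume.restrict (Metric.ball x r)) := by
    constructor
    rw [Measure.smul_apply, Measure.restrict_apply_univ, smul_eq_mul]
    exact ENNReal.inv_mul_cancel (volume_ball_ne_zero x hr) measure_ball_lt_top.ne
  have hmeas : AEStronglyMeasurable V
      ((volume (Metric.ball x r))⁻¹ • volume.restrict (Metric.ball x r)) :=
    (hV.aestronglyMeasurable.restrict).smul_measure _
  refine le_trans (le_of_eq ?_) (eLpNorm_le_eLpNorm_of_exponent_le hs hmeas)
  have ht : ((d : ℝ≥0∞) / 2).toReal = (d : ℝ) / 2 := by simp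
  rw [eLpNorm_eq_lintegral_rpow_enorm_toReal, ht, lintegral_smul_measure, smul_eq_mul, one_div_div]
  · congr 2
    refine lintegral_congr fun y => ?_
    rw [Real.enorm_of_nonneg (hV0 y)]
  · simp
    omega
  · exact ENNReal.div_ne_top (by simp) (by simp)

/-- The potential measured in `L^{d/2}`: `∫_{B(x,r)} V^{d/2}` as a real number. -/
noncomputable def halfDimMass (V : EuclideanSpace ℝ (Fin d) → ℝ) (x : EuclideanSpace ℝ (Fin d))
    (r : ℝ) : ℝ :=
  (∫⁻ y in Metric.ball x r, ENNReal.ofReal (V y) ^ ((d : ℝ) / 2)).toReal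

theorem halfDimMass_nonneg (x : EuclideanSpace ℝ (Fin d)) (r : ℝ) : 0 ≤ halfDimMass V x r :=
  ENNReal.toReal_nonneg

theorem lintegral_ofReal_lt_top (hV : LocallyIntegrable V volume)
    (x : EuclideanSpace ℝ (Fin d)) (r : ℝ) :
    ∫⁻ y in Metric.ball x r, ENNReal.ofReal (V y) < ∞ :=
  lt_of_le_of_lt (lintegral_ofReal_le_lintegral_enorm V)
    (integrableOn_ball_of_locallyIntegrable hV x r).2

/-- Since `halfDimMass` is a `toReal`, an infinite integral would read as `0`; this finiteness makes
its monotonicity and additivity meaningful. -/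
theorem ReverseHolder.lintegral_rpow_lt_top (hd : 3 ≤ d) (hV0 : ∀ x, 0 ≤ V x)
    (hV : LocallyIntegrable V volume) (hs : (d : ℝ≥0∞) / 2 ≤ s) (h : ReverseHolder V s)
    (x : EuclideanSpace ℝ (Fin d)) {r : ℝ} (hr : 0 < r) :
    ∫⁻ y in Metric.ball x r, ENNReal.ofReal (V y) ^ ((d : ℝ) / 2) < ∞ := by
  obtain ⟨C, hC, h⟩ := h.exists_half_dim hd hV0 hV hs
  have h1 := h x r hr
  have hd0 : (0 : ℝ) < 2 / d := by positivity
  have hB := volume_ball_ne_zero x hr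
  have hB' : volume (Metric.ball x r) ≠ ∞ := measure_ball_lt_top.ne
  have h2 : ENNReal.ofReal C *
      ((volume (Metric.ball x r))⁻¹ * ∫⁻ y in Metric.ball x r, ENNReal.ofReal (V y)) < ∞ :=
    ENNReal.mul_lt_top ENNReal.ofReal_lt_top
      (ENNReal.mul_lt_top (ENNReal.inv_lt_top.2 (pos_iff_ne_zero.2 hB))
        (lintegral_ofReal_lt_top hV x r))
  have h3 := (ENNReal.rpow_lt_top_iff_of_pos hd0).1 (h1.trans_lt h2)
  by_contra h4
  rw [not_lt, top_le_iff] at h4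
  rw [h4, ENNReal.mul_top (ENNReal.inv_ne_zero.2 hB')] at h3
  exact lt_irrefl _ h3

/-- The reverse Hölder inequality in real form. -/
theorem ReverseHolder.exists_halfDimMass_le (hd : 3 ≤ d) (hV0 : ∀ x, 0 ≤ V x)
    (hV : LocallyIntegrable V volume) (hs : (d : ℝ≥0∞) / 2 ≤ s) (h : ReverseHolder V s) :
    ∃ C : ℝ, 0 < C ∧ ∀ (x : EuclideanSpace ℝ (Fin d)) (r : ℝ), 0 < r →
      halfDimMass V x r ^ (2 / (d : ℝ)) * volume.real (Metric.ball x r) ^ (1 - 2 / (d : ℝ)) ≤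
        C * ∫ y in Metric.ball x r, V y := by
  obtain ⟨C, hC, h⟩ := h.exists_half_dim hd hV0 hV hs
  refine ⟨C, hC, fun x r hr => ?_⟩
  have h1 := h x r hr
  have hfin : ENNReal.ofReal C *
      ((volume (Metric.ball x r))⁻¹ * ∫⁻ y in Metric.ball x r, ENNReal.ofReal (V y)) < ∞ :=
    ENNReal.mul_lt_top ENNReal.ofReal_lt_top
      (ENNReal.mul_lt_top (ENNReal.inv_lt_top.2 (pos_iff_ne_zero.2 (volume_ball_ne_zero x hr)))
        (lintegral_ofReal_lt_top hV x r))
  have h2 := ENNReal.toReal_mono hfin.ne h1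
  rw [← ENNReal.toReal_rpow, ENNReal.toReal_mul, ENNReal.toReal_mul, ENNReal.toReal_mul,
    ENNReal.toReal_inv, ENNReal.toReal_ofReal hC.le] at h2
  have h3 : (∫⁻ y in Metric.ball x r, ENNReal.ofReal (V y)).toReal =
      ∫ y in Metric.ball x r, V y := by
    rw [integral_eq_lintegral_of_nonneg_ae (Filter.Eventually.of_forall hV0)
      hV.aestronglyMeasurable.restrict]
  rw [h3] at h2
  change ((volume.real (Metric.ball x r))⁻¹ * halfDimMass V x r) ^ (2 / (d : ℝ)) ≤
    C * ((volume.real (Metric.ball x r))⁻¹ * _) at h2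
  have hv : 0 < volume.real (Metric.ball x r) :=
    ENNReal.toReal_pos (volume_ball_ne_zero x hr) measure_ball_lt_top.ne
  rw [Real.mul_rpow (by positivity) (halfDimMass_nonneg x r), Real.inv_rpow hv.le] at h2
  have h5 : 0 < volume.real (Metric.ball x r) ^ (2 / (d : ℝ)) := by positivity
  rw [Real.rpow_sub hv, Real.rpow_one]
  rw [inv_mul_eq_div, div_le_iff₀ h5] at h2
  calc _ = volume.real (Metric.ball x r) *
        (halfDimMass V x r ^ (2 / (d : ℝ)) / volume.real (Metric.ball x r) ^ (2 / (d : ℝ))) := by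
          ring
    _ ≤ volume.real (Metric.ball x r) * (C * ((volume.real (Metric.ball x r))⁻¹ *
          ∫ y in Metric.ball x r, V y)) := by
      gcongr
      rw [div_le_iff₀ h5]
      exact h2
    _ = _ := by field_simp

/-- Hölder's inequality on a subset of a ball. -/
theorem ReverseHolder.setIntegral_le (hd : 3 ≤ d) (hV0 : ∀ x, 0 ≤ V x)
    (hV : LocallyIntegrable V volume) (hs : (d : ℝ≥0∞) / 2 ≤ s) (h : ReverseHolder V s)
    (x : EuclideanSpace ℝ (Fin d)) {r : ℝ} (hr : 0 < r) {E : Set (EuclideanSpace ℝ (Fin d))}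
    (hE : E ⊆ Metric.ball x r) :
    ∫ y in E, V y ≤ halfDimMass V x r ^ (2 / (d : ℝ)) * volume.real E ^ (1 - 2 / (d : ℝ)) := by
  have hd3 : (3 : ℝ) ≤ d := by exact_mod_cast hd
  have hpq : ((d : ℝ) / 2).HolderConjugate (1 - 2 / (d : ℝ))⁻¹ := by
    rw [Real.holderConjugate_iff]
    constructor
    · linarith
    · rw [inv_inv, inv_div]
      ring
  have hm : AEMeasurable (fun y => ENNReal.ofReal (V y)) (volume.restrict E) :=
    hV.aestronglyMeasurable.aemeasurable.ennreal_ofReal.restrict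
  have h1 := ENNReal.lintegral_mul_le_Lp_mul_Lq (volume.restrict E) hpq hm
    (aemeasurable_const (b := (1 : ℝ≥0∞)))
  simp only [Pi.mul_apply, mul_one, ENNReal.one_rpow, lintegral_one, Measure.restrict_apply_univ,
    one_div, inv_inv, inv_div] at h1
  have h2 : (∫⁻ y in E, ENNReal.ofReal (V y) ^ ((d : ℝ) / 2)) ≤
      ∫⁻ y in Metric.ball x r, ENNReal.ofReal (V y) ^ ((d : ℝ) / 2) := lintegral_mono_set hE
  have h3 := h1.trans (mul_le_mul_left (ENNReal.rpow_le_rpow h2 (by positivity)) _)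
  rw [integral_eq_lintegral_of_nonneg_ae (Filter.Eventually.of_forall hV0)
      hV.aestronglyMeasurable.restrict]
  have hex : 0 ≤ 1 - 2 / (d : ℝ) := by
    rw [sub_nonneg, div_le_one (by linarith)]
    linarith
  have h4 := ENNReal.toReal_mono ?_ h3
  · rw [ENNReal.toReal_mul, ← ENNReal.toReal_rpow, ← ENNReal.toReal_rpow] at h4
    exact h4
  · refine ENNReal.mul_ne_top (ENNReal.rpow_ne_top_of_nonneg (by positivity)
      (h.lintegral_rpow_lt_top hd hV0 hV hs x hr).ne) (ENNReal.rpow_ne_top_of_nonneg hex ?_)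
    exact ((measure_mono hE).trans_lt measure_ball_lt_top).ne

theorem ReverseHolder.halfDimMass_mono (hd : 3 ≤ d) (hV0 : ∀ x, 0 ≤ V x)
    (hV : LocallyIntegrable V volume) (hs : (d : ℝ≥0∞) / 2 ≤ s) (h : ReverseHolder V s)
    {x y : EuclideanSpace ℝ (Fin d)} {r R : ℝ} (hR : 0 < R)
    (hsub : Metric.ball x r ⊆ Metric.ball y R) : halfDimMass V x r ≤ halfDimMass V y R :=
  ENNReal.toReal_mono (h.lintegral_rpow_lt_top hd hV0 hV hs y hR).ne (lintegral_mono_set hsub)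

theorem ReverseHolder.halfDimMass_add_le (hd : 3 ≤ d) (hV0 : ∀ x, 0 ≤ V x)
    (hV : LocallyIntegrable V volume) (hs : (d : ℝ≥0∞) / 2 ≤ s) (h : ReverseHolder V s)
    {x y z : EuclideanSpace ℝ (Fin d)} {r R : ℝ} (hr : 0 < r) (hR : 0 < R)
    (hdisj : Disjoint (Metric.ball x r) (Metric.ball y r))
    (hx : Metric.ball x r ⊆ Metric.ball z R) (hy : Metric.ball y r ⊆ Metric.ball z R) :
    halfDimMass V x r + halfDimMass V y r ≤ halfDimMass V z R := by
  unfold halfDimMass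
  rw [← ENNReal.toReal_add (h.lintegral_rpow_lt_top hd hV0 hV hs x hr).ne
    (h.lintegral_rpow_lt_top hd hV0 hV hs y hr).ne,
    ← lintegral_union Metric.isOpen_ball.measurableSet hdisj]
  exact ENNReal.toReal_mono (h.lintegral_rpow_lt_top hd hV0 hV hs z hR).ne
    (lintegral_mono_set (Set.union_subset hx hy))

theorem setIntegral_ball_mono (hV0 : ∀ x, 0 ≤ V x) (hV : LocallyIntegrable V volume)
    {x y : EuclideanSpace ℝ (Fin d)} {r R : ℝ} (hsub : Metric.ball x r ⊆ Metric.ball y R) :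
    ∫ z in Metric.ball x r, V z ≤ ∫ z in Metric.ball y R, V z :=
  setIntegral_mono_set (integrableOn_ball_of_locallyIntegrable hV y R)
    (Filter.Eventually.of_forall hV0) hsub.eventuallyLE

/-- The mass of `V` on balls grows at most polynomially in the radius. -/
theorem ReverseHolder.exists_setIntegral_growth (hd : 3 ≤ d) (hV0 : ∀ x, 0 ≤ V x)
    (hV : LocallyIntegrable V volume) (hs : (d : ℝ≥0∞) / 2 ≤ s) (h : ReverseHolder V s) :
    ∃ κ : ℝ, 0 < κ ∧ ∀ (x : EuclideanSpace ℝ (Fin d)) (r R : ℝ), 0 < r → r ≤ R →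
      ∫ y in Metric.ball x R, V y ≤ 2 * (R / r) ^ κ * ∫ y in Metric.ball x r, V y := by
  obtain ⟨C, hC, hCN⟩ := h.exists_halfDimMass_le hd hV0 hV hs
  have hd3 : (3 : ℝ) ≤ d := by exact_mod_cast hd
  set a := 1 - 2 / (d : ℝ) with ha
  have ha0 : 0 < a := by
    rw [ha, sub_pos, div_lt_one (by linarith)]
    linarith
  -- Hölder and reverse Hölder bound the mass of the annulus between radii `r` and `lam * r` by `C *
  -- (1 - lam⁻¹ ^ d) ^ a` times the mass of the larger ball. For `lam` near `1` this is at most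
  -- half, so the mass at most doubles under dilation by `lam`.
  obtain ⟨lam, hlam, hlamC⟩ : ∃ lam : ℝ, 1 < lam ∧ C * (1 - (lam⁻¹) ^ d) ^ a ≤ 1 / 2 := by
    have hcont : Filter.Tendsto (fun lam : ℝ => C * (1 - (lam⁻¹) ^ d) ^ a)
        (nhdsWithin 1 (Set.Ioi 1)) (nhds (C * (1 - ((1 : ℝ)⁻¹) ^ d) ^ a)) := by
      refine Filter.Tendsto.mono_left ?_ nhdsWithin_le_nhds
      refine Filter.Tendsto.const_mul _ (Filter.Tendsto.rpow_const ?_ (Or.inr ha0.le))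
      refine Filter.Tendsto.const_sub _ (Filter.Tendsto.pow ?_ _)
      exact tendsto_inv₀ one_ne_zero
    have hz : C * (1 - ((1 : ℝ)⁻¹) ^ d) ^ a = 0 := by
      simp [Real.zero_rpow ha0.ne']
    rw [hz] at hcont
    have := (hcont.eventually_lt_const (show (0 : ℝ) < 1 / 2 by norm_num)).and self_mem_nhdsWithin
    obtain ⟨lam, h1, h2⟩ := this.exists
    exact ⟨lam, h2, h1.le⟩
  refine ⟨Real.logb lam 2, Real.logb_pos hlam (by norm_num), fun x r R hr hrR => ?_⟩
  have hlam0 : 0 < lam := one_pos.trans hlam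
  refine le_rpow_of_doubling (g := fun r => ∫ y in Metric.ball x r, V y) hlam (by norm_num)
    (fun r R _ hrR => setIntegral_ball_mono hV0 hV (Metric.ball_subset_ball hrR))
    (fun r _ => integral_nonneg hV0) (fun r hr => ?_) hr hrR
  have hlr : 0 < lam * r := by positivity
  have hle : r ≤ lam * r := le_mul_of_one_le_left hr.le hlam.le
  have hsub : Metric.ball x r ⊆ Metric.ball x (lam * r) := Metric.ball_subset_ball hle
  have h1 := h.setIntegral_le hd hV0 hV hs x hlr
    (Set.sdiff_subset (s := Metric.ball x (lam * r)) (t := Metric.ball x r))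
  rw [setIntegral_sdiff Metric.isOpen_ball.measurableSet
    (integrableOn_ball_of_locallyIntegrable hV x _) hsub,
    measureReal_sdiff hsub Metric.isOpen_ball.measurableSet measure_ball_lt_top.ne] at h1
  have hv : volume.real (Metric.ball x (lam * r)) - volume.real (Metric.ball x r) =
      volume.real (Metric.ball x (lam * r)) * (1 - (lam⁻¹) ^ d) := by
    rw [volume_real_ball_eq hd x hlr.le, volume_real_ball_eq hd x hr.le, mul_pow, inv_pow]
    field_simp
  have hpow : 0 ≤ 1 - (lam⁻¹) ^ d := by
    rw [sub_nonneg]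
    exact pow_le_one₀ (by positivity) (inv_le_one_of_one_le₀ hlam.le)
  rw [hv, Real.mul_rpow measureReal_nonneg hpow, ← mul_assoc] at h1
  have h2 : (0 : ℝ) ≤ (1 - (lam⁻¹) ^ d) ^ a := by positivity
  have h3 := mul_le_mul_of_nonneg_right (hCN x (lam * r) hlr) h2
  have h4 : 0 ≤ ∫ y in Metric.ball x (lam * r), V y := integral_nonneg hV0
  have h5 := mul_le_mul_of_nonneg_right hlamC h4
  change _ ≤ 2 * ∫ y in Metric.ball x r, V y
  linarith

/-- By the growth bound, a vanishing mass on one ball would vanish on all larger concentric balls,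
and so `V` would be zero almost everywhere. -/
theorem ReverseHolder.setIntegral_ball_pos (hd : 3 ≤ d) (hV0 : ∀ x, 0 ≤ V x)
    (hV : LocallyIntegrable V volume) (hs : (d : ℝ≥0∞) / 2 ≤ s) (h : ReverseHolder V s)
    (hne : ¬ V =ᵐ[volume] 0) (x : EuclideanSpace ℝ (Fin d)) {r : ℝ} (hr : 0 < r) :
    0 < ∫ y in Metric.ball x r, V y := by
  obtain ⟨κ, -, hκ⟩ := h.exists_setIntegral_growth hd hV0 hV hs
  refine lt_of_le_of_ne (integral_nonneg hV0) fun h0 => hne ?_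
  have hz : ∀ n : ℕ, ∀ᵐ y ∂volume.restrict (Metric.ball x (r + n)), V y = 0 := by
    intro n
    have h1 := hκ x r (r + n) hr (by simp)
    rw [← h0, mul_zero] at h1
    exact (integral_eq_zero_iff_of_nonneg hV0
      (integrableOn_ball_of_locallyIntegrable hV x _)).1 (h1.antisymm (integral_nonneg hV0))
  have hU : (⋃ n : ℕ, Metric.ball x (r + n)) = Set.univ := by
    refine Set.eq_univ_of_forall fun y => Set.mem_iUnion.2 ?_
    obtain ⟨n, hn⟩ := exists_nat_gt (dist y x)
    exact ⟨n, Metric.mem_ball.2 (by linarith)⟩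
  have := ae_restrict_iUnion_iff (μ := volume) (fun n : ℕ => Metric.ball x (r + n))
    (fun y => V y = 0)
  rw [hU, Measure.restrict_univ] at this
  exact this.2 hz

theorem exists_dist_eq_euclidean (hd : 3 ≤ d) (x : EuclideanSpace ℝ (Fin d)) {t : ℝ} (ht : 0 ≤ t) :
    ∃ y, dist x y = t := by
  refine ⟨x + EuclideanSpace.single ⟨0, by omega⟩ t, ?_⟩
  simp [abs_of_nonneg ht]

/-- The critical radius function of a potential in `RH_s`, `s ≥ d/2`, is positive and slowly
varying. -/
theorem ReverseHolder.criticalRadius_pos_and_slowVariation (hd : 3 ≤ d) (hV0 : ∀ x, 0 ≤ V x)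
    (hV : LocallyIntegrable V volume) (hs : (d : ℝ≥0∞) / 2 ≤ s) (h : ReverseHolder V s)
    (hne : ¬ V =ᵐ[volume] 0) :
    (∀ x, 0 < criticalRadius V x) ∧ ∃ N₀, IsSlowVariationExponent (criticalRadius V) N₀ := by
  obtain ⟨C, hC, hCN⟩ := h.exists_halfDimMass_le hd hV0 hV hs
  obtain ⟨κ, hκ, hgrow⟩ := h.exists_setIntegral_growth hd hV0 hV hs
  have hd3 : (3 : ℝ) ≤ d := by exact_mod_cast hd
  set e := 2 / (d : ℝ) with he
  have he0 : 0 < e := by positivity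
  set v := volume.real (Metric.ball (0 : EuclideanSpace ℝ (Fin d)) 1) with hv
  have hv0 : 0 < v :=
    ENNReal.toReal_pos (volume_ball_ne_zero 0 one_pos) measure_ball_lt_top.ne
  set c := v ^ (1 - e) with hc
  have hc0 : 0 < c := by positivity
  set N := halfDimMass V with hN
  have hNnn : ∀ x r, 0 ≤ N x r := fun x r => halfDimMass_nonneg x r
  have hz : ∀ r : ℝ, r ^ ((d : ℤ) - 2) = r ^ (d - 2) := by
    intro r
    rw [← zpow_natCast]
    congr 1
    omega
  have hvol : ∀ (x : EuclideanSpace ℝ (Fin d)) (r : ℝ), 0 < r →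
      volume.real (Metric.ball x r) ^ (1 - e) = c * r ^ (d - 2) := by
    intro x r hr
    rw [volume_real_ball_eq hd x hr.le, Real.mul_rpow (by positivity) hv0.le, mul_comm, hc]
    congr 1
    rw [← Real.rpow_natCast, ← Real.rpow_natCast, ← Real.rpow_mul hr.le, Nat.cast_sub (by omega)]
    congr 1
    rw [he]
    field_simp
    norm_num
  set ψ : EuclideanSpace ℝ (Fin d) → ℝ → ℝ :=
    fun x r => 1 / r ^ ((d : ℤ) - 2) * ∫ y in Metric.ball x r, V y with hψ
  -- Hölder gives this bound and reverse Hölder the next one. The factor `|B| ^ (1 - 2/d) = c * r ^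
  -- (d - 2)` is exactly the normalisation in `ψ`.
  have hψN : ∀ x r, 0 < r → ψ x r ≤ c * N x r ^ e := by
    intro x r hr
    have h1 := h.setIntegral_le hd hV0 hV hs x hr (subset_refl _)
    rw [← he, hvol x r hr] at h1
    simp only [hψ, hz]
    rw [one_div, inv_mul_le_iff₀ (by positivity)]
    linarith
  have hNψ : ∀ x r, 0 < r → c * N x r ^ e ≤ C * ψ x r := by
    intro x r hr
    have h1 := hCN x r hr
    rw [hvol x r hr] at h1
    simp only [hψ, hz]
    have h2 : 0 < r ^ (d - 2) := by positivity
    rw [one_div, ← mul_assoc, mul_comm C, mul_assoc, le_inv_mul_iff₀ h2]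
    linarith
  have hpos : ∀ x r, 0 < r → 0 < ψ x r := by
    intro x r hr
    have := h.setIntegral_ball_pos hd hV0 hV hs hne x hr
    simp only [hψ]
    positivity
  have hup : ∀ x r R, 0 < r → r ≤ R → ψ x R ≤ 2 * (R / r) ^ κ * ψ x r := by
    intro x r R hr hrR
    have h0 : 0 ≤ ∫ y in Metric.ball x r, V y := integral_nonneg hV0
    have hR : 0 < R := hr.trans_le hrR
    simp only [hψ, hz]
    calc _ ≤ 1 / r ^ (d - 2) * (2 * (R / r) ^ κ * ∫ y in Metric.ball x r, V y) := by
          have h1 := hgrow x r R hr hrR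
          have h2 : 1 / R ^ (d - 2) ≤ 1 / r ^ (d - 2) := by gcongr
          exact mul_le_mul h2 h1 (integral_nonneg hV0) (by positivity)
      _ = _ := by ring
  have hmove : ∀ x y R, 0 < R → dist x y ≤ R → ψ y R ≤ 2 ^ (d - 2) * ψ x (2 * R) := by
    intro x y R hR hxy
    have h1 : ∫ z in Metric.ball y R, V z ≤ ∫ z in Metric.ball x (2 * R), V z := by
      refine setIntegral_ball_mono hV0 hV (Metric.ball_subset_ball' ?_)
      rw [dist_comm]
      linarith
    simp only [hψ, hz]
    calc _ ≤ 1 / R ^ (d - 2) * ∫ z in Metric.ball x (2 * R), V z := by gcongr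
      _ = _ := by
        rw [mul_pow]
        field_simp
  set D := (C * (2 * 4 ^ κ)) ^ e⁻¹ with hD
  have hD0 : 0 < D := by positivity
  have hDN : ∀ x r, 0 < r → N x (4 * r) ≤ D * N x r := by
    intro x r hr
    have h1 := hNψ x (4 * r) (by positivity)
    have h2 := hup x r (4 * r) hr (by linarith)
    rw [mul_div_cancel_right₀ _ hr.ne'] at h2
    have h3 := hψN x r hr
    have h4 : c * N x (4 * r) ^ e ≤ c * (C * (2 * 4 ^ κ) * N x r ^ e) := by
      calc _ ≤ C * ψ x (4 * r) := h1
        _ ≤ C * (2 * 4 ^ κ * (c * N x r ^ e)) := by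
          gcongr
          exact h2.trans (by gcongr)
        _ = _ := by ring
    have h5 := le_of_mul_le_mul_left h4 hc0
    have h6 := Real.rpow_le_rpow (Real.rpow_nonneg (hNnn _ _) _) h5 (inv_nonneg.2 he0.le)
    rwa [← Real.rpow_mul (hNnn _ _), mul_inv_cancel₀ he0.ne', Real.rpow_one,
      Real.mul_rpow (by positivity) (Real.rpow_nonneg (hNnn _ _) _), ← Real.rpow_mul (hNnn _ _),
      mul_inv_cancel₀ he0.ne', Real.rpow_one] at h6
  set K := 1 + D⁻¹ with hK
  have hK1 : 1 < K := lt_add_of_pos_right _ (by positivity)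
  -- With `dist x y = 2 * r`, the balls of radius `r` about `x` and `y` are disjoint inside `B(x,
  -- 4r)`, and doubling of `N` gives the second at least `D⁻¹` of the mass of the first, because
  -- `B(x, r) ⊆ B(y, 4r)`.
  have hrev : ∀ x r, 0 < r → K * N x r ≤ N x (4 * r) := by
    intro x r hr
    obtain ⟨y, hy⟩ := exists_dist_eq_euclidean hd x (t := 2 * r) (by positivity)
    have h1 : N x r + N y r ≤ N x (4 * r) := by
      refine h.halfDimMass_add_le hd hV0 hV hs hr (by positivity) ?_ ?_ ?_
      · exact Metric.ball_disjoint_ball (by linarith)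
      · exact Metric.ball_subset_ball (by linarith)
      · refine Metric.ball_subset_ball' ?_
        rw [dist_comm]
        linarith
    have h2 : N x r ≤ D * N y r := by
      refine le_trans (h.halfDimMass_mono hd hV0 hV hs (by positivity) ?_) (hDN y r hr)
      refine Metric.ball_subset_ball' ?_
      linarith
    have h3 : D⁻¹ * N x r ≤ N y r := (inv_mul_le_iff₀ hD0).2 h2
    rw [hK, add_mul, one_mul]
    linarith
  set ε := Real.logb 4 K with hε
  have hε0 : 0 < ε := Real.logb_pos (by norm_num) hK1
  have hlow : ∀ x r R, 0 < r → r ≤ R → ψ x r ≤ C * K ^ e * (r / R) ^ (ε * e) * ψ x R := by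
    intro x r R hr hrR
    have hR : 0 < R := hr.trans_le hrR
    have h1 : N x r ≤ K * (r / R) ^ ε * N x R :=
      le_rpow_of_reverse_doubling (by norm_num) hK1.le
        (fun r R hr hrR => h.halfDimMass_mono hd hV0 hV hs (hr.trans_le hrR)
          (Metric.ball_subset_ball hrR)) (fun r _ => hNnn x r) (hrev x) hr hrR
    have h2 := Real.rpow_le_rpow (hNnn _ _) h1 he0.le
    have hK0 : 0 < K := one_pos.trans hK1
    rw [Real.mul_rpow (by positivity) (hNnn _ _), Real.mul_rpow hK0.le (by positivity),
      ← Real.rpow_mul (by positivity)] at h2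
    calc ψ x r ≤ c * N x r ^ e := hψN x r hr
      _ ≤ c * (K ^ e * (r / R) ^ (ε * e) * N x R ^ e) := by gcongr
      _ = K ^ e * (r / R) ^ (ε * e) * (c * N x R ^ e) := by ring
      _ ≤ K ^ e * (r / R) ^ (ε * e) * (C * ψ x R) := by
        exact mul_le_mul_of_nonneg_left (hNψ x R hR) (by positivity)
      _ = _ := by ring
  have hK0 : 0 < K := one_pos.trans hK1
  exact ⟨fun x => (sSup_sublevel_pos_and_le (by positivity) hκ (by positivity) two_pos hpos hlow
      hup x).2.1, κ / (ε * e),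
    isSlowVariationExponent_sSup (by positivity) hκ (by positivity) two_pos (by positivity) hpos
      hlow hup hmove⟩
end

/-! ### Weights of class `A_{p,q}`. -/

section
variable {d : ℕ} {ρ f ω : EuclideanSpace ℝ (Fin d) → ℝ} {x₀ : EuclideanSpace ℝ (Fin d)}
  {r p q β θ : ℝ}

theorem growthFactor_ne_zero (hρ : ∀ x, 0 < ρ x) (x : EuclideanSpace ℝ (Fin d)) (hr : 0 < r) :
    growthFactor ρ x r θ ≠ 0 := by
  have := hρ x
  unfold growthFactor
  rw [ENNReal.ofReal_ne_zero_iff]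
  positivity

theorem growthFactor_mul (hρ : ∀ x, 0 < ρ x) (x : EuclideanSpace ℝ (Fin d)) (hr : 0 < r)
    (a b : ℝ) : growthFactor ρ x r a * growthFactor ρ x r b = growthFactor ρ x r (a + b) := by
  have := hρ x
  unfold growthFactor
  rw [← ENNReal.ofReal_mul (by positivity), ← Real.rpow_add (by positivity)]

/-- The normalised Lebesgue measure on a ball. -/
noncomputable def ballProb (x : EuclideanSpace ℝ (Fin d)) (r : ℝ) :
    Measure (EuclideanSpace ℝ (Fin d)) :=
  (volume (Metric.ball x r))⁻¹ • volume.restrict (Metric.ball x r)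

theorem isProbabilityMeasure_ballProb (x : EuclideanSpace ℝ (Fin d)) (hr : 0 < r) :
    IsProbabilityMeasure (ballProb x r) := by
  constructor
  rw [ballProb, Measure.smul_apply, Measure.restrict_apply_univ, smul_eq_mul]
  exact ENNReal.inv_mul_cancel (volume_ball_ne_zero x hr) measure_ball_lt_top.ne

theorem lintegral_ballProb (x : EuclideanSpace ℝ (Fin d)) (r : ℝ)
    (g : EuclideanSpace ℝ (Fin d) → ℝ≥0∞) :
    ∫⁻ y, g y ∂ballProb x r = (volume (Metric.ball x r))⁻¹ * ∫⁻ y in Metric.ball x r, g y := by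
  rw [ballProb, lintegral_smul_measure, smul_eq_mul]

theorem ballProb_absolutelyContinuous (x : EuclideanSpace ℝ (Fin d)) (r : ℝ) :
    ballProb x r ≪ volume.restrict (Metric.ball x r) := Measure.smul_absolutelyContinuous

/-- The factor of the `A_{p,q}` characteristic that involves negative powers of the weight. -/
noncomputable def dualFactor (p : ℝ) (ω : EuclideanSpace ℝ (Fin d) → ℝ)
    (x₀ : EuclideanSpace ℝ (Fin d)) (r : ℝ) : ℝ≥0∞ :=
  if p = 1 then
    (essInf (fun x => ENNReal.ofReal (ω x)) (volume.restrict (Metric.ball x₀ r)))⁻¹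
  else
    ((volume (Metric.ball x₀ r))⁻¹ *
      ∫⁻ x in Metric.ball x₀ r, ENNReal.ofReal (ω x) ^ (-(p / (p - 1)))) ^ (1 / (p / (p - 1)))

theorem growthFactor_mul_le_apqConst (x₀ : EuclideanSpace ℝ (Fin d)) (hr : 0 < r) :
    growthFactor ρ x₀ r (-θ) *
      ((volume (Metric.ball x₀ r))⁻¹ * weightMass ω q (Metric.ball x₀ r)) ^ (1 / q) *
        dualFactor p ω x₀ r ≤ apqConst ρ p q θ ω :=
  le_iSup₂_of_le (f := fun (x₀ : EuclideanSpace ℝ (Fin d)) (r : ℝ) => ⨆ (_ : 0 < r),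
    growthFactor ρ x₀ r (-θ) *
      ((volume (Metric.ball x₀ r))⁻¹ * weightMass ω q (Metric.ball x₀ r)) ^ (1 / q) *
        dualFactor p ω x₀ r) x₀ r (le_iSup (fun _ : 0 < r => _) hr)

theorem restrict_ball_ne_zero (x₀ : EuclideanSpace ℝ (Fin d)) (hr : 0 < r) :
    volume.restrict (Metric.ball x₀ r) ≠ 0 := by
  rw [Ne, Measure.restrict_eq_zero]
  exact volume_ball_ne_zero x₀ hr

theorem dualFactor_ne_zero (hp : 1 ≤ p) (hω : AEMeasurable ω volume)
    (x₀ : EuclideanSpace ℝ (Fin d)) (hr : 0 < r) : dualFactor p ω x₀ r ≠ 0 := by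
  have hne : (ae (volume.restrict (Metric.ball x₀ r))).NeBot :=
    ae_neBot.2 (restrict_ball_ne_zero x₀ hr)
  unfold dualFactor
  split_ifs with h1
  · rw [Ne, ENNReal.inv_eq_zero]
    intro htop
    have h2 := ae_essInf_le (μ := volume.restrict (Metric.ball x₀ r))
      (f := fun x => ENNReal.ofReal (ω x))
    obtain ⟨y, hy⟩ := h2.exists
    rw [htop, top_le_iff] at hy
    exact ENNReal.ofReal_ne_top hy
  · have hp1 : 1 < p := lt_of_le_of_ne hp (Ne.symm h1)
    have hp' : 0 < p / (p - 1) := div_pos (by linarith) (by linarith)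
    rw [Ne, ENNReal.rpow_eq_zero_iff_of_pos (by positivity), mul_eq_zero, not_or]
    refine ⟨ENNReal.inv_ne_zero.2 measure_ball_lt_top.ne, fun h0 => ?_⟩
    rw [lintegral_eq_zero_iff' (hω.ennreal_ofReal.pow_const _).restrict] at h0
    obtain ⟨y, hy⟩ := h0.exists
    simp only [Pi.zero_apply, ENNReal.rpow_eq_zero_iff] at hy
    rcases hy with ⟨-, h⟩ | ⟨h, -⟩
    · linarith
    · exact ENNReal.ofReal_ne_top h

theorem ae_ne_zero_of_dualFactor_ne_top (hp : 1 ≤ p) (hω : AEMeasurable ω volume)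
    (h : dualFactor p ω x₀ r ≠ ∞) :
    ∀ᵐ x ∂volume.restrict (Metric.ball x₀ r), ENNReal.ofReal (ω x) ≠ 0 := by
  unfold dualFactor at h
  split_ifs at h with h1
  · rw [Ne, ENNReal.inv_eq_top] at h
    filter_upwards [ae_essInf_le (μ := volume.restrict (Metric.ball x₀ r))
      (f := fun x => ENNReal.ofReal (ω x))] with y hy h0
    rw [h0, nonpos_iff_eq_zero] at hy
    exact h hy
  · have hp1 : 1 < p := lt_of_le_of_ne hp (Ne.symm h1)
    have hp' : 0 < p / (p - 1) := div_pos (by linarith) (by linarith)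
    have h2 : ∫⁻ x in Metric.ball x₀ r, ENNReal.ofReal (ω x) ^ (-(p / (p - 1))) ≠ ∞ := by
      intro htop
      rw [htop, ENNReal.mul_top (ENNReal.inv_ne_zero.2 measure_ball_lt_top.ne),
        ENNReal.top_rpow_of_pos (by positivity)] at h
      exact h rfl
    filter_upwards [ae_lt_top' (hω.ennreal_ofReal.pow_const _).restrict h2] with y hy h0
    rw [h0, ENNReal.zero_rpow_of_neg (by linarith)] at hy
    exact lt_irrefl _ hy

/-- Since `∞ * 0 = 0` in `[0,∞]`, a finite characteristic excludes infinite mass only because the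
growth factor and the dual factor never vanish. -/
theorem MemApq.weightMass_ne_top (hρ : ∀ x, 0 < ρ x) (hp : 1 ≤ p) (hq : 0 < q)
    (h : MemApq ρ p q θ ω) (x₀ : EuclideanSpace ℝ (Fin d)) (hr : 0 < r) :
    weightMass ω q (Metric.ball x₀ r) ≠ ∞ := by
  intro htop
  have hm : AEMeasurable ω volume := h.1.locallyIntegrable.aestronglyMeasurable.aemeasurable
  have h1 := (growthFactor_mul_le_apqConst (ρ := ρ) (ω := ω) (p := p) (q := q) (θ := θ)
    x₀ hr).trans_lt h.2
  rw [htop, ENNReal.mul_top (ENNReal.inv_ne_zero.2 measure_ball_lt_top.ne),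
    ENNReal.top_rpow_of_pos (by positivity), ENNReal.mul_top (growthFactor_ne_zero hρ x₀ hr),
    ENNReal.top_mul (dualFactor_ne_zero hp hm x₀ hr)] at h1
  exact lt_irrefl _ h1

theorem weightMass_eq_zero_iff (hq : 0 < q) (hω : AEMeasurable ω volume)
    (S : Set (EuclideanSpace ℝ (Fin d))) :
    weightMass ω q S = 0 ↔ ∀ᵐ x ∂volume.restrict S, ENNReal.ofReal (ω x) = 0 := by
  unfold weightMass
  rw [lintegral_eq_zero_iff' (hω.ennreal_ofReal.pow_const _).restrict]
  refine Filter.eventually_congr (Filter.Eventually.of_forall fun x => ?_)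
  simp [ENNReal.rpow_eq_zero_iff_of_pos hq]

/-- On a ball of positive mass the dual factor must be finite, which forbids zeros of `ω` on a set
of positive measure. Some ball about the origin has positive mass, hence so do all larger ones, and
these exhaust the space. -/
theorem MemApq.ae_ne_zero (hρ : ∀ x, 0 < ρ x) (hp : 1 ≤ p) (hq : 0 < q)
    (h : MemApq ρ p q θ ω) : ∀ᵐ x ∂volume, ENNReal.ofReal (ω x) ≠ 0 := by
  have hm : AEMeasurable ω volume := h.1.locallyIntegrable.aestronglyMeasurable.aemeasurable
  have hball : ∀ n : ℕ, weightMass ω q (Metric.ball 0 (n + 1)) ≠ 0 →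
      ∀ᵐ x ∂volume.restrict (Metric.ball (0 : EuclideanSpace ℝ (Fin d)) (n + 1)),
        ENNReal.ofReal (ω x) ≠ 0 := by
    intro n hn
    have hr : (0 : ℝ) < n + 1 := by positivity
    refine ae_ne_zero_of_dualFactor_ne_top (p := p) hp hm fun htop => ?_
    have h1 := (growthFactor_mul_le_apqConst (ρ := ρ) (ω := ω) (p := p) (q := q) (θ := θ)
      0 hr).trans_lt h.2
    rw [htop, ENNReal.mul_top] at h1
    · exact lt_irrefl _ h1
    · refine mul_ne_zero (growthFactor_ne_zero hρ 0 hr) ?_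
      rw [Ne, ENNReal.rpow_eq_zero_iff_of_pos (by positivity), mul_eq_zero, not_or]
      exact ⟨ENNReal.inv_ne_zero.2 measure_ball_lt_top.ne, hn⟩
  have hU : ∀ k : ℕ, (⋃ n : ℕ, Metric.ball (0 : EuclideanSpace ℝ (Fin d)) ((k + n : ℕ) + 1)) =
      Set.univ := by
    intro k
    refine Set.eq_univ_of_forall fun y => Set.mem_iUnion.2 ?_
    obtain ⟨n, hn⟩ := exists_nat_gt (dist y 0)
    refine ⟨n, Metric.mem_ball.2 ?_⟩
    push_cast
    have : (0 : ℝ) ≤ k := by positivity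
    linarith
  obtain ⟨k, hk⟩ : ∃ k : ℕ, weightMass ω q
      (Metric.ball (0 : EuclideanSpace ℝ (Fin d)) (k + 1)) ≠ 0 := by
    by_contra! hall
    apply h.1.not_ae_zero
    have h2 := (ae_restrict_iUnion_iff (μ := volume)
      (fun n : ℕ => Metric.ball (0 : EuclideanSpace ℝ (Fin d)) ((0 + n : ℕ) + 1))
      (fun y => ENNReal.ofReal (ω y) = 0)).2
      fun n => (weightMass_eq_zero_iff hq hm _).1 (hall _)
    rw [hU 0, Measure.restrict_univ] at h2
    filter_upwards [h2] with x hx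
    exact le_antisymm (ENNReal.ofReal_eq_zero.1 hx) (h.1.nonneg x)
  have h2 := (ae_restrict_iUnion_iff (μ := volume)
    (fun n : ℕ => Metric.ball (0 : EuclideanSpace ℝ (Fin d)) ((k + n : ℕ) + 1))
    (fun y => ENNReal.ofReal (ω y) ≠ 0)).2 fun n => hball _ fun h0 => hk ?_
  · rwa [hU k, Measure.restrict_univ] at h2
  · refine le_antisymm (le_trans (lintegral_mono_set (Metric.ball_subset_ball ?_)) h0.le) bot_le
    push_cast
    have : (0 : ℝ) ≤ n := by positivity
    linarith

theorem MemApq.weightMass_ne_zero (hρ : ∀ x, 0 < ρ x) (hp : 1 ≤ p) (hq : 0 < q)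
    (h : MemApq ρ p q θ ω) (x₀ : EuclideanSpace ℝ (Fin d)) (hr : 0 < r) :
    weightMass ω q (Metric.ball x₀ r) ≠ 0 := by
  have hm : AEMeasurable ω volume := h.1.locallyIntegrable.aestronglyMeasurable.aemeasurable
  rw [Ne, weightMass_eq_zero_iff hq hm]
  intro h0
  have hne : (ae (volume.restrict (Metric.ball x₀ r))).NeBot :=
    ae_neBot.2 (restrict_ball_ne_zero x₀ hr)
  obtain ⟨y, hy, hy'⟩ := (h0.and (ae_restrict_of_ae (h.ae_ne_zero hρ hp hq))).exists
  exact hy' hy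

/-- Hölder's inequality: the mean of `g` is controlled by its weighted `L^q` mean. -/
theorem MemApq.mean_le (hρ : ∀ x, 0 < ρ x) (hp : 1 ≤ p) (hpq : p ≤ q)
    (h : MemApq ρ p q θ ω) (x₀ : EuclideanSpace ℝ (Fin d)) (hr : 0 < r)
    {g : EuclideanSpace ℝ (Fin d) → ℝ≥0∞} (hg : AEMeasurable g volume) :
    (volume (Metric.ball x₀ r))⁻¹ * ∫⁻ x in Metric.ball x₀ r, g x ≤
      ((volume (Metric.ball x₀ r))⁻¹ *
        ∫⁻ x in Metric.ball x₀ r, g x ^ q * ENNReal.ofReal (ω x) ^ q) ^ (1 / q) *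
          dualFactor p ω x₀ r := by
  have hp0 : 0 < p := one_pos.trans_le hp
  have hq0 : 0 < q := hp0.trans_le hpq
  have hm : AEMeasurable ω volume := h.1.locallyIntegrable.aestronglyMeasurable.aemeasurable
  have hprob := isProbabilityMeasure_ballProb x₀ hr
  have hac : ballProb x₀ r ≪ (volume : Measure (EuclideanSpace ℝ (Fin d))) :=
    (ballProb_absolutelyContinuous x₀ r).trans Measure.restrict_le_self.absolutelyContinuous
  have hmw : AEMeasurable (fun x => ENNReal.ofReal (ω x)) (ballProb x₀ r) :=
    (hm.mono_ac hac).ennreal_ofReal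
  have hmg : AEMeasurable g (ballProb x₀ r) := hg.mono_ac hac
  have hmgw : AEMeasurable (fun x => g x * ENNReal.ofReal (ω x)) (ballProb x₀ r) := hmg.mul hmw
  have hne : ∀ᵐ x ∂ballProb x₀ r, ENNReal.ofReal (ω x) ≠ 0 :=
    hac.ae_le (h.ae_ne_zero hρ hp hq0)
  -- Splitting `g` as `(g ω) ω⁻¹` lets Hölder's inequality with exponents `p` and `p'` (or the bound
  -- on `ω⁻¹` when `p = 1`) produce the dual factor; `hmono` then raises `p` to `q` on a probability
  -- measure.
  have hcancel : ∀ᵐ x ∂ballProb x₀ r,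
      g x = g x * ENNReal.ofReal (ω x) * (ENNReal.ofReal (ω x))⁻¹ := by
    filter_upwards [hne] with x hx
    rw [mul_assoc, ENNReal.mul_inv_cancel hx ENNReal.ofReal_ne_top, mul_one]
  have hmono := eLpNorm'_le_eLpNorm'_of_exponent_le hp0 hpq (ballProb x₀ r)
    hmgw.aestronglyMeasurable
  simp only [eLpNorm', enorm_eq_self] at hmono
  have hq' : ∫⁻ x, (g x * ENNReal.ofReal (ω x)) ^ q ∂ballProb x₀ r =
      (volume (Metric.ball x₀ r))⁻¹ *
        ∫⁻ x in Metric.ball x₀ r, g x ^ q * ENNReal.ofReal (ω x) ^ q := by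
    rw [lintegral_ballProb]
    congr 1
    exact lintegral_congr fun x => ENNReal.mul_rpow_of_nonneg _ _ hq0.le
  rw [hq'] at hmono
  rw [← lintegral_ballProb]
  refine le_trans ?_ (mul_le_mul_left hmono _)
  unfold dualFactor
  split_ifs with h1
  · subst h1
    simp only [ENNReal.rpow_one, one_div_one]
    rw [← lintegral_mul_const'' _ hmgw]
    refine lintegral_mono_ae ?_
    filter_upwards [hcancel, (ballProb_absolutelyContinuous x₀ r).ae_le
      (ae_essInf_le (μ := volume.restrict (Metric.ball x₀ r))
        (f := fun x => ENNReal.ofReal (ω x)))] with x hx hx'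
    calc g x = g x * ENNReal.ofReal (ω x) * (ENNReal.ofReal (ω x))⁻¹ := hx
      _ ≤ _ := by gcongr
  · have hp1 : 1 < p := lt_of_le_of_ne hp (Ne.symm h1)
    have hconj : p.HolderConjugate (p / (p - 1)) := Real.HolderConjugate.conjExponent hp1
    have h2 := ENNReal.lintegral_mul_le_Lp_mul_Lq (ballProb x₀ r) hconj hmgw hmw.inv
    calc ∫⁻ x, g x ∂ballProb x₀ r = ∫⁻ x, ((fun x => g x * ENNReal.ofReal (ω x)) *
          (fun x => ENNReal.ofReal (ω x))⁻¹) x ∂ballProb x₀ r := lintegral_congr_ae hcancel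
      _ ≤ _ := h2
      _ = _ := by
        rw [← lintegral_ballProb]
        congr 2
        refine lintegral_congr fun x => ?_
        rw [Pi.inv_apply, ENNReal.inv_rpow, ENNReal.rpow_neg]

/-- Hölder's inequality applied to the constant `1` shows that the characteristic dominates `(1 + r
/ ρ 0) ^ (-θ)` for every `r > 0`; then `r → 0`. -/
theorem MemApq.one_le_apqConst (hρ : ∀ x, 0 < ρ x) (hp : 1 ≤ p) (hpq : p ≤ q)
    (h : MemApq ρ p q θ ω) : 1 ≤ apqConst ρ p q θ ω := by
  have hball : ∀ r, 0 < r → growthFactor ρ 0 r (-θ) ≤ apqConst ρ p q θ ω := by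
    intro r hr
    have h1 := h.mean_le hρ hp hpq 0 hr (aemeasurable_const (b := (1 : ℝ≥0∞)))
    simp only [lintegral_one, Measure.restrict_apply_univ, ENNReal.one_rpow, one_mul] at h1
    rw [ENNReal.inv_mul_cancel (volume_ball_ne_zero _ hr) measure_ball_lt_top.ne] at h1
    calc growthFactor ρ 0 r (-θ) = growthFactor ρ 0 r (-θ) * 1 := (mul_one _).symm
      _ ≤ growthFactor ρ 0 r (-θ) * _ := mul_le_mul_right h1 _
      _ ≤ _ := by
        rw [← mul_assoc]
        exact growthFactor_mul_le_apqConst 0 hr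
  have hlim : Filter.Tendsto (fun r => growthFactor ρ 0 r (-θ)) (nhdsWithin 0 (Set.Ioi 0))
      (nhds 1) := by
    refine Filter.Tendsto.mono_left ?_ nhdsWithin_le_nhds
    have hc : ContinuousAt (fun r : ℝ => (1 + r / ρ 0) ^ (-θ)) 0 := by
      refine ContinuousAt.rpow_const (by fun_prop) (Or.inl ?_)
      simp
    have := (ENNReal.continuous_ofReal.tendsto _).comp hc.tendsto
    simpa [growthFactor, Function.comp_def] using this
  refine le_of_tendsto hlim ?_
  filter_upwards [self_mem_nhdsWithin] with r hr using hball r hr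

/-! ### Finiteness of the lower oscillation, and the converse estimate. -/

theorem aemeasurable_lowerOsc (hf : AEMeasurable f volume) (x₀ : EuclideanSpace ℝ (Fin d))
    (r : ℝ) : AEMeasurable (lowerOsc f x₀ r) volume := by
  have h : Measurable fun t : ℝ => ((t : EReal) -
      essInf (fun y => (f y : EReal)) (volume.restrict (Metric.ball x₀ r))).toENNReal := by
    refine Measurable.ereal_toENNReal (Monotone.measurable fun s t hst => ?_)
    exact EReal.sub_le_sub (EReal.coe_le_coe_iff.2 hst) le_rfl
  exact h.comp_aemeasurable hf

/-- If the oscillation is integrable over a ball, the essential infimum there is finite. -/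
theorem exists_lowerOsc_eq_ofReal (hr : 0 < r)
    (h : ∫⁻ x in Metric.ball x₀ r, lowerOsc f x₀ r x ≠ ∞) (hf : AEMeasurable f volume) :
    ∃ m : ℝ, essInf (fun y => (f y : EReal)) (volume.restrict (Metric.ball x₀ r)) = m ∧
      (∀ᵐ x ∂volume.restrict (Metric.ball x₀ r), m ≤ f x) ∧
      ∀ x, lowerOsc f x₀ r x = ENNReal.ofReal (f x - m) := by
  have hne : (ae (volume.restrict (Metric.ball x₀ r))).NeBot :=
    ae_neBot.2 (restrict_ball_ne_zero x₀ hr)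
  have hle := ae_essInf_le (μ := volume.restrict (Metric.ball x₀ r))
    (f := fun x => (f x : EReal))
  obtain ⟨y, hy, hy'⟩ :=
    (hle.and (ae_lt_top' (aemeasurable_lowerOsc hf x₀ r).restrict h)).exists
  have htop : essInf (fun y => (f y : EReal)) (volume.restrict (Metric.ball x₀ r)) ≠ ⊤ := by
    intro ht
    rw [ht, top_le_iff] at hy
    exact EReal.coe_ne_top _ hy
  have hbot : essInf (fun y => (f y : EReal)) (volume.restrict (Metric.ball x₀ r)) ≠ ⊥ := by
    intro ht
    rw [lowerOsc, ht, EReal.coe_sub_bot, EReal.toENNReal_top] at hy'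
    exact lt_irrefl _ hy'
  have hm := EReal.coe_toReal htop hbot
  refine ⟨_, hm.symm, ?_, fun x => ?_⟩
  · filter_upwards [hle] with x hx
    rw [← hm] at hx
    exact_mod_cast hx
  · rw [lowerOsc, ← hm, ← EReal.coe_sub, EReal.real_coe_toENNReal, EReal.toReal_coe]

theorem integrableOn_of_lintegral_lowerOsc_ne_top (hr : 0 < r) (hf : AEMeasurable f volume)
    (h : ∫⁻ x in Metric.ball x₀ r, lowerOsc f x₀ r x ≠ ∞) :
    IntegrableOn f (Metric.ball x₀ r) volume := by
  obtain ⟨m, -, hm, hosc⟩ := exists_lowerOsc_eq_ofReal hr h hf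
  have hint : IntegrableOn (fun x => f x - m) (Metric.ball x₀ r) volume := by
    refine ⟨(hf.sub_const m).aestronglyMeasurable.restrict, ?_⟩
    rw [hasFiniteIntegral_iff_ofReal]
    · simp only [← hosc]
      exact h.lt_top
    · filter_upwards [hm] with x hx using sub_nonneg.2 hx
  have := hint.add (integrableOn_const (C := m) (measure_ball_lt_top (x := x₀) (r := r)).ne)
  refine this.congr (Filter.Eventually.of_forall fun x => ?_)
  simp

theorem le_campanatoLowerConst (x₀ : EuclideanSpace ℝ (Fin d)) (hr : 0 < r) :
    growthFactor ρ x₀ r (-θ) *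
      ((volume (Metric.ball x₀ r) ^ (1 + β / (d : ℝ)))⁻¹ *
        ∫⁻ x in Metric.ball x₀ r, lowerOsc f x₀ r x) ≤ campanatoLowerConst ρ β θ f :=
  le_iSup₂_of_le (f := fun (x₀ : EuclideanSpace ℝ (Fin d)) (r : ℝ) => ⨆ (_ : 0 < r),
    growthFactor ρ x₀ r (-θ) *
      ((volume (Metric.ball x₀ r) ^ (1 + β / (d : ℝ)))⁻¹ *
        ∫⁻ x in Metric.ball x₀ r, lowerOsc f x₀ r x)) x₀ r (le_iSup (fun _ : 0 < r => _) hr)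

theorem lintegral_lowerOsc_ne_top (hρ : ∀ x, 0 < ρ x)
    (h : campanatoLowerConst ρ β θ f < ∞) (x₀ : EuclideanSpace ℝ (Fin d)) (hr : 0 < r) :
    ∫⁻ x in Metric.ball x₀ r, lowerOsc f x₀ r x ≠ ∞ := by
  intro htop
  have h1 := (le_campanatoLowerConst (ρ := ρ) (β := β) (θ := θ) (f := f) x₀ hr).trans_lt h
  rw [htop, ENNReal.mul_top, ENNReal.mul_top (growthFactor_ne_zero hρ x₀ hr)] at h1
  · exact lt_irrefl _ h1
  · rw [ENNReal.inv_ne_zero]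
    exact ENNReal.rpow_ne_top_of_ne_zero (volume_ball_ne_zero x₀ hr) measure_ball_lt_top.ne

theorem locallyIntegrable_of_campanatoLowerConst_lt_top (hρ : ∀ x, 0 < ρ x)
    (hf : AEMeasurable f volume) (h : campanatoLowerConst ρ β θ f < ∞) :
    LocallyIntegrable f volume := fun x =>
  ⟨Metric.ball x 1, Metric.ball_mem_nhds x one_pos,
    integrableOn_of_lintegral_lowerOsc_ne_top one_pos hf
      (lintegral_lowerOsc_ne_top hρ h x one_pos)⟩

/-- A bound for the weighted oscillations bounds the `C^{β,*}_{ρ,θ}`-constant. -/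
theorem MemApq.campanatoLowerConst_le {θ₁ θ₂ : ℝ} (hρ : ∀ x, 0 < ρ x) (hp : 1 ≤ p)
    (hpq : p ≤ q) (h : MemApq ρ p q θ₂ ω) (hf : AEMeasurable f volume) {K : ℝ≥0∞}
    (hK : ∀ (x₀ : EuclideanSpace ℝ (Fin d)) (r : ℝ), 0 < r →
      weightedOsc ω q β f x₀ r ≤ K * apqConst ρ p q θ₂ ω * growthFactor ρ x₀ r (θ₁ - θ₂)) :
    campanatoLowerConst ρ β θ₁ f ≤ K * apqConst ρ p q θ₂ ω ^ 2 := by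
  have hq0 : 0 < q := one_pos.trans_le (hp.trans hpq)
  refine iSup_le fun x₀ => iSup_le fun r => iSup_le fun hr => ?_
  set v := volume (Metric.ball x₀ r) with hv
  have hv0 : v ≠ 0 := volume_ball_ne_zero x₀ hr
  have hvt : v ≠ ∞ := measure_ball_lt_top.ne
  set M := weightMass ω q (Metric.ball x₀ r) with hM
  have hM0 : M ≠ 0 := h.weightMass_ne_zero hρ hp hq0 x₀ hr
  have hMt : M ≠ ∞ := h.weightMass_ne_top hρ hp hq0 x₀ hr
  set I := ∫⁻ x in Metric.ball x₀ r, lowerOsc f x₀ r x ^ q * ENNReal.ofReal (ω x) ^ q with hI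
  set J := ∫⁻ x in Metric.ball x₀ r, lowerOsc f x₀ r x with hJ
  set A := apqConst ρ p q θ₂ ω with hA
  have h1 : v⁻¹ * J ≤ (v⁻¹ * I) ^ (1 / q) * dualFactor p ω x₀ r :=
    h.mean_le hρ hp hpq x₀ hr (aemeasurable_lowerOsc hf x₀ r)
  -- Passing from Lebesgue to `ω^q` normalisation requires `0 < M < ∞`. The leftover mean `v⁻¹ * M`
  -- pairs with the dual factor to give the second power of the characteristic.
  have h2 : v⁻¹ * I = (M⁻¹ * I) * (v⁻¹ * M) := by
    rw [show M⁻¹ * I * (v⁻¹ * M) = M⁻¹ * M * (v⁻¹ * I) by ring,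
      ENNReal.inv_mul_cancel hM0 hMt, one_mul]
  have h3 : (v ^ (1 + β / (d : ℝ)))⁻¹ = (v ^ (β / (d : ℝ)))⁻¹ * v⁻¹ := by
    rw [ENNReal.rpow_add _ _ hv0 hvt, ENNReal.rpow_one, mul_comm,
      ENNReal.mul_inv (Or.inr hvt) (Or.inr hv0)]
  rw [h2, ENNReal.mul_rpow_of_nonneg _ _ (by positivity)] at h1
  have hgrow : growthFactor ρ x₀ r (-θ₁) * growthFactor ρ x₀ r (θ₁ - θ₂) =
      growthFactor ρ x₀ r (-θ₂) := by
    rw [growthFactor_mul hρ x₀ hr]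
    congr 1
    ring
  calc growthFactor ρ x₀ r (-θ₁) * ((v ^ (1 + β / (d : ℝ)))⁻¹ * J)
      = growthFactor ρ x₀ r (-θ₁) * ((v ^ (β / (d : ℝ)))⁻¹ * (v⁻¹ * J)) := by
        rw [h3, mul_assoc]
    _ ≤ growthFactor ρ x₀ r (-θ₁) * ((v ^ (β / (d : ℝ)))⁻¹ *
          ((M⁻¹ * I) ^ (1 / q) * (v⁻¹ * M) ^ (1 / q) * dualFactor p ω x₀ r)) := by gcongr
    _ = growthFactor ρ x₀ r (-θ₁) * weightedOsc ω q β f x₀ r *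
          ((v⁻¹ * M) ^ (1 / q) * dualFactor p ω x₀ r) := by
        unfold weightedOsc
        ring
    _ ≤ growthFactor ρ x₀ r (-θ₁) * (K * A * growthFactor ρ x₀ r (θ₁ - θ₂)) *
          ((v⁻¹ * M) ^ (1 / q) * dualFactor p ω x₀ r) := by
        gcongr
        exact hK x₀ r hr
    _ = K * A * ((growthFactor ρ x₀ r (-θ₁) * growthFactor ρ x₀ r (θ₁ - θ₂)) *
          (v⁻¹ * M) ^ (1 / q) * dualFactor p ω x₀ r) := by ring
    _ ≤ K * A * A := by
        rw [hgrow]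
        gcongr
        exact growthFactor_mul_le_apqConst x₀ hr
    _ = K * A ^ 2 := by ring
end

/-! ### Pointwise bounds at Lebesgue points, and the direct estimate. -/

/-- If averages `a k` stay within a geometrically decaying distance above an increasing
sequence of minorants `m k`, where `m (k+1) - m k` is controlled by the same quantity, then the
limit of `a` exceeds `m 0` by at most a geometric sum. -/
theorem limit_le_of_geometric_gap {a m : ℕ → ℝ} {H L t y : ℝ} (ht0 : 0 ≤ t) (ht1 : t < 1)
    (hH : 0 ≤ H) (hL : 0 ≤ L) (hgap : ∀ k, a k - m k ≤ H * t ^ k)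
    (hstep : ∀ k, m (k + 1) - m k ≤ L * (H * t ^ k))
    (ha : Filter.Tendsto a Filter.atTop (nhds y)) : y - m 0 ≤ (1 + L / (1 - t)) * H := by
  have h1t : 0 < 1 - t := by linarith
  have hm : ∀ k, m k - m 0 ≤ L * H * ((1 - t ^ k) / (1 - t)) := by
    intro k
    induction k with
    | zero => simp
    | succ k ih =>
      have h1 : L * H * ((1 - t ^ (k + 1)) / (1 - t)) =
          L * H * ((1 - t ^ k) / (1 - t)) + L * (H * t ^ k) := by
        field_simp
        ring
      linarith [hstep k]
  have hbound : ∀ k, a k ≤ m 0 + (1 + L / (1 - t)) * H := by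
    intro k
    have h1 : H * t ^ k ≤ H := mul_le_of_le_one_right hH (pow_le_one₀ ht0 ht1.le)
    have h2 : L * H * ((1 - t ^ k) / (1 - t)) ≤ L * H * (1 / (1 - t)) := by
      gcongr
      linarith [pow_nonneg ht0 k]
    have h3 : L * H * (1 / (1 - t)) = L / (1 - t) * H := by ring
    linarith [hgap k, hm k]
  have := le_of_tendsto' ha hbound
  linarith

section
variable {d : ℕ} {ρ f ω : EuclideanSpace ℝ (Fin d) → ℝ} {x₀ : EuclideanSpace ℝ (Fin d)}
  {r p q β θ : ℝ}

/-- Lebesgue differentiation along closed balls transfers to open balls because spheres are null.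
One exceptional set serves all `R`. -/
theorem ae_tendsto_average_ball (hd : 3 ≤ d) (hf : LocallyIntegrable f volume) :
    ∀ᵐ x, ∀ R : ℝ, 0 < R → Filter.Tendsto
      (fun k : ℕ => ⨍ y in Metric.ball x (R / 2 ^ k), f y) Filter.atTop (nhds (f x)) := by
  filter_upwards [IsUnifLocDoublingMeasure.ae_tendsto_average volume hf 1] with x hx R hR
  have hlim : Filter.Tendsto (fun k : ℕ => R / 2 ^ k) Filter.atTop (nhdsWithin 0 (Set.Ioi 0)) := by
    refine tendsto_nhdsWithin_iff.2 ⟨?_, Filter.Eventually.of_forall fun k => by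
      simp only [Set.mem_Ioi]; positivity⟩
    have := (tendsto_pow_atTop_nhds_zero_of_lt_one (r := (2 : ℝ)⁻¹) (by norm_num)
      (by norm_num)).const_mul R
    simpa [div_eq_mul_inv] using this
  have h1 := hx (fun _ : ℕ => x) (fun k => R / 2 ^ k) hlim
    (Filter.Eventually.of_forall fun k => Metric.mem_closedBall_self (by positivity))
  refine h1.congr fun k => ?_
  have : Nonempty (Fin d) := ⟨⟨0, by omega⟩⟩
  refine setAverage_congr ?_
  refine (Metric.ball_subset_closedBall.eventuallyLE.antisymm ?_).symm
  exact (ae_le_set.2 (by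
    rw [Metric.closedBall_sdiff_ball]
    exact Measure.addHaar_sphere volume x _))

/-- The mean oscillation over a ball in real form. -/
theorem average_sub_le (hρ : ∀ x, 0 < ρ x) (h : MemCampanatoLower ρ β θ f)
    (x : EuclideanSpace ℝ (Fin d)) (hr : 0 < r) {m : ℝ}
    (hm : ∀ᵐ y ∂volume.restrict (Metric.ball x r), m ≤ f y)
    (hosc : ∀ y, lowerOsc f x r y = ENNReal.ofReal (f y - m)) :
    (⨍ y in Metric.ball x r, f y) - m ≤ (campanatoLowerConst ρ β θ f).toReal *
      (1 + r / ρ x) ^ θ * volume.real (Metric.ball x r) ^ (β / (d : ℝ)) := by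
  set v := volume.real (Metric.ball x r) with hv
  have hv0 : 0 < v := ENNReal.toReal_pos (volume_ball_ne_zero x hr) measure_ball_lt_top.ne
  have hu : 0 < 1 + r / ρ x := by
    have := hρ x
    positivity
  have hint : IntegrableOn f (Metric.ball x r) volume :=
    integrableOn_ball_of_locallyIntegrable h.1 x r
  have h1 := ENNReal.toReal_mono h.2.ne
    (le_campanatoLowerConst (ρ := ρ) (β := β) (θ := θ) (f := f) x hr)
  have h2 : (∫⁻ y in Metric.ball x r, lowerOsc f x r y).toReal =
      ∫ y in Metric.ball x r, (f y - m) := by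
    have hms : AEStronglyMeasurable (fun y => f y - m) (volume.restrict (Metric.ball x r)) :=
      h.1.aestronglyMeasurable.restrict.sub aestronglyMeasurable_const
    rw [integral_eq_lintegral_of_nonneg_ae
      (by filter_upwards [hm] with y hy using sub_nonneg.2 hy) hms]
    simp only [hosc]
  have h3 : ∫ y in Metric.ball x r, (f y - m) = v * ((⨍ y in Metric.ball x r, f y) - m) := by
    rw [integral_sub hint (integrableOn_const measure_ball_lt_top.ne), setIntegral_const,
      setAverage_eq, smul_eq_mul, smul_eq_mul, ← hv]
    field_simp
  rw [ENNReal.toReal_mul, ENNReal.toReal_mul, ENNReal.toReal_inv, ← ENNReal.toReal_rpow, h2, h3,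
    growthFactor, ENNReal.toReal_ofReal (by positivity), ← measureReal_def, ← hv,
    Real.rpow_add hv0, Real.rpow_one, Real.rpow_neg hu.le] at h1
  have h4 : 0 < (1 + r / ρ x) ^ θ := by positivity
  have h5 : 0 < v ^ (β / (d : ℝ)) := by positivity
  rw [inv_mul_le_iff₀ h4, inv_mul_le_iff₀ (by positivity)] at h1
  refine le_of_mul_le_mul_left ?_ hv0
  calc _ ≤ _ := h1
    _ = _ := by ring

/-- Since `f - m ≥ 0`, halving the radius can only decrease its integral, while the volume drops by
`2 ^ d`. This controls the increments of the essential infima. -/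
theorem average_sub_le_of_subset (hd : 3 ≤ d) (hf : LocallyIntegrable f volume)
    (x : EuclideanSpace ℝ (Fin d)) (hr : 0 < r) {m : ℝ}
    (hm : ∀ᵐ y ∂volume.restrict (Metric.ball x r), m ≤ f y) :
    (⨍ y in Metric.ball x (r / 2), f y) - m ≤ 2 ^ d * ((⨍ y in Metric.ball x r, f y) - m) := by
  have hsub : Metric.ball x (r / 2) ⊆ Metric.ball x r := Metric.ball_subset_ball (by linarith)
  have hav : ∀ s : ℝ, 0 < s → ∫ y in Metric.ball x s, (f y - m) =
      volume.real (Metric.ball x s) * ((⨍ y in Metric.ball x s, f y) - m) := by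
    intro s hs
    have hv0 : 0 < volume.real (Metric.ball x s) :=
      ENNReal.toReal_pos (volume_ball_ne_zero x hs) measure_ball_lt_top.ne
    rw [integral_sub (integrableOn_ball_of_locallyIntegrable hf x s)
      (integrableOn_const measure_ball_lt_top.ne), setIntegral_const,
      setAverage_eq, smul_eq_mul, smul_eq_mul]
    field_simp
  have hmono : ∫ y in Metric.ball x (r / 2), (f y - m) ≤ ∫ y in Metric.ball x r, (f y - m) := by
    refine setIntegral_mono_set ?_ ?_ hsub.eventuallyLE
    · exact (integrableOn_ball_of_locallyIntegrable hf x r).sub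
        (integrableOn_const measure_ball_lt_top.ne)
    · filter_upwards [hm] with y hy using sub_nonneg.2 hy
  rw [hav _ (half_pos hr), hav _ hr, volume_real_ball_eq hd x hr.le,
    volume_real_ball_eq hd x (half_pos hr).le, div_pow] at hmono
  have hv0 : 0 < volume.real (Metric.ball (0 : EuclideanSpace ℝ (Fin d)) 1) :=
    ENNReal.toReal_pos (volume_ball_ne_zero _ one_pos) measure_ball_lt_top.ne
  set v := volume.real (Metric.ball (0 : EuclideanSpace ℝ (Fin d)) 1)
  have hrd : 0 < r ^ d * v := by positivity
  refine le_of_mul_le_mul_left ?_ hrd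
  have h2 : (0 : ℝ) < 2 ^ d := by positivity
  calc _ = 2 ^ d * (r ^ d / 2 ^ d * v * ((⨍ y in Metric.ball x (r / 2), f y) - m)) := by
        field_simp
    _ ≤ 2 ^ d * (r ^ d * v * ((⨍ y in Metric.ball x r, f y) - m)) := by gcongr
    _ = _ := by ring

theorem volume_real_ball_rpow (hd : 3 ≤ d) (x : EuclideanSpace ℝ (Fin d)) (hr : 0 < r) :
    volume.real (Metric.ball x r) ^ (β / (d : ℝ)) =
      r ^ β * volume.real (Metric.ball (0 : EuclideanSpace ℝ (Fin d)) 1) ^ (β / (d : ℝ)) := by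
  have hd0 : (d : ℝ) ≠ 0 := by
    have : d ≠ 0 := by omega
    exact_mod_cast this
  rw [volume_real_ball_eq hd x hr.le, Real.mul_rpow (by positivity) measureReal_nonneg,
    ← Real.rpow_natCast, ← Real.rpow_mul hr.le, mul_div_cancel₀ _ hd0]

/-- The constant in the pointwise bound for functions of class `C^{β,*}_{ρ,θ}`. -/
noncomputable def pointwiseConst (d : ℕ) (β : ℝ) : ℝ := 1 + 2 ^ d / (1 - 2 ^ (-β))

theorem two_rpow_neg_lt_one (hβ : 0 < β) : (2 : ℝ) ^ (-β) < 1 :=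
  Real.rpow_lt_one_of_one_lt_of_neg (by norm_num) (by linarith)

theorem pointwiseConst_pos (hβ : 0 < β) : 0 < pointwiseConst d β := by
  have : 0 < 1 - (2 : ℝ) ^ (-β) := sub_pos.2 (two_rpow_neg_lt_one hβ)
  unfold pointwiseConst
  positivity

/-- At a Lebesgue point `x` the value of `f` exceeds the essential infimum of `f` over
`B(x, R)` by at most a multiple of the oscillation bound for `B(x, R)`. -/
theorem MemCampanatoLower.ae_sub_le (hd : 3 ≤ d) (hρ : ∀ x, 0 < ρ x) (hβ : 0 < β) (hθ : 0 ≤ θ)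
    (h : MemCampanatoLower ρ β θ f) :
    ∀ᵐ x, ∀ R : ℝ, 0 < R → ∃ m : ℝ,
      essInf (fun y => (f y : EReal)) (volume.restrict (Metric.ball x R)) = m ∧
      f x - m ≤ pointwiseConst d β * ((campanatoLowerConst ρ β θ f).toReal *
        (1 + R / ρ x) ^ θ * volume.real (Metric.ball x R) ^ (β / (d : ℝ))) := by
  have hfm : AEMeasurable f volume := h.1.aestronglyMeasurable.aemeasurable
  filter_upwards [ae_tendsto_average_ball hd h.1] with x hx R hR
  have hRk : ∀ k : ℕ, 0 < R / 2 ^ k := fun k => by positivity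
  have hex := fun k : ℕ => exists_lowerOsc_eq_ofReal (hRk k)
    (lintegral_lowerOsc_ne_top hρ h.2 x (hRk k)) hfm
  choose m hm1 hm2 hm3 using hex
  refine ⟨m 0, by simpa using hm1 0, ?_⟩
  set A := (campanatoLowerConst ρ β θ f).toReal with hA
  have hA0 : 0 ≤ A := ENNReal.toReal_nonneg
  have hρx := hρ x
  set H := A * (1 + R / ρ x) ^ θ * volume.real (Metric.ball x R) ^ (β / (d : ℝ)) with hH
  -- The growth factor only decreases with the radius, so all the decay comes from `|B| ^ (β/d)`,
  -- which gains `2 ^ (-β)` per halving.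
  have hgap : ∀ k, (⨍ y in Metric.ball x (R / 2 ^ k), f y) - m k ≤ H * ((2 : ℝ) ^ (-β)) ^ k := by
    intro k
    refine (average_sub_le hρ h x (hRk k) (hm2 k) (hm3 k)).trans ?_
    have hle : R / 2 ^ k ≤ R := div_le_self hR.le (one_le_pow₀ (by norm_num))
    have hpow : (R / 2 ^ k) ^ β = R ^ β * ((2 : ℝ) ^ (-β)) ^ k := by
      rw [Real.div_rpow hR.le (by positivity), ← Real.rpow_natCast, ← Real.rpow_mul (by norm_num),
        ← Real.rpow_natCast, ← Real.rpow_mul (by norm_num), div_eq_mul_inv,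
        ← Real.rpow_neg (by norm_num)]
      congr 2
      ring
    rw [hH, volume_real_ball_rpow hd x (hRk k), volume_real_ball_rpow hd x hR, hpow, ← hA]
    calc _ ≤ A * (1 + R / ρ x) ^ θ * (R ^ β * ((2 : ℝ) ^ (-β)) ^ k *
          volume.real (Metric.ball (0 : EuclideanSpace ℝ (Fin d)) 1) ^ (β / (d : ℝ))) := by
          gcongr
      _ = _ := by ring
  have hstep : ∀ k, m (k + 1) - m k ≤ 2 ^ d * (H * ((2 : ℝ) ^ (-β)) ^ k) := by
    intro k
    have h1 := average_sub_le_of_subset hd h.1 x (hRk k) (hm2 k)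
    have h2 : R / 2 ^ k / 2 = R / 2 ^ (k + 1) := by
      rw [pow_succ, div_div]
    rw [h2] at h1
    have h3 : m (k + 1) ≤ ⨍ y in Metric.ball x (R / 2 ^ (k + 1)), f y := by
      have h4 := setIntegral_mono_on_ae (μ := volume) (s := Metric.ball x (R / 2 ^ (k + 1)))
        (f := fun _ => m (k + 1)) (g := f) (integrableOn_const measure_ball_lt_top.ne)
        (integrableOn_ball_of_locallyIntegrable h.1 x _) Metric.isOpen_ball.measurableSet
        ((ae_restrict_iff' Metric.isOpen_ball.measurableSet).1 (hm2 (k + 1)))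
      have hv0 : 0 < volume.real (Metric.ball x (R / 2 ^ (k + 1))) :=
        ENNReal.toReal_pos (volume_ball_ne_zero x (hRk _)) measure_ball_lt_top.ne
      rw [setAverage_eq, smul_eq_mul, le_inv_mul_iff₀ hv0]
      rwa [setIntegral_const, smul_eq_mul] at h4
    have h5 : (2 : ℝ) ^ d * ((⨍ y in Metric.ball x (R / 2 ^ k), f y) - m k) ≤
        2 ^ d * (H * ((2 : ℝ) ^ (-β)) ^ k) :=
      mul_le_mul_of_nonneg_left (hgap k) (by positivity)
    linarith
  exact limit_le_of_geometric_gap (by positivity) (two_rpow_neg_lt_one hβ) (by positivity)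
    (by positivity) hgap hstep (hx R hR)

/-- Pointwise form of the `C^{β,*}_{ρ,θ}` condition on a ball. -/
theorem MemCampanatoLower.ae_lowerOsc_le {N₀ C₀ : ℝ} (hd : 3 ≤ d) (hρ : ∀ x, 0 < ρ x)
    (hβ : 0 < β) (hθ : 0 ≤ θ) (hN : 0 ≤ N₀) (hC : 1 ≤ C₀)
    (hslow : ∀ x y : EuclideanSpace ℝ (Fin d),
      1 / C₀ * (1 + dist x y / ρ x) ^ (-N₀) ≤ ρ y / ρ x)
    (h : MemCampanatoLower ρ β θ f) (x₀ : EuclideanSpace ℝ (Fin d)) (hr : 0 < r) :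
    ∀ᵐ x ∂volume.restrict (Metric.ball x₀ r), lowerOsc f x₀ r x ≤
      ENNReal.ofReal (pointwiseConst d β * (4 * C₀) ^ θ * 2 ^ β) * campanatoLowerConst ρ β θ f *
        growthFactor ρ x₀ r ((N₀ + 1) * θ) * volume (Metric.ball x₀ r) ^ (β / (d : ℝ)) := by
  have hfm : AEMeasurable f volume := h.1.aestronglyMeasurable.aemeasurable
  obtain ⟨m, hm1, -, hm3⟩ := exists_lowerOsc_eq_ofReal hr
    (lintegral_lowerOsc_ne_top hρ h.2 x₀ hr) hfm
  filter_upwards [ae_restrict_of_ae (h.ae_sub_le hd hρ hβ hθ),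
    ae_restrict_mem Metric.isOpen_ball.measurableSet] with x hx hxB
  -- The pointwise bound is centred at `x`, so it is applied on `B(x, 2r) ⊇ B(x₀, r)`, where the
  -- essential infimum is no larger.
  have hR : 0 < 2 * r := by positivity
  obtain ⟨m', hm', hle⟩ := hx (2 * r) hR
  have hdist : dist x x₀ < r := Metric.mem_ball.1 hxB
  have hmm : m' ≤ m := by
    have hsub : Metric.ball x₀ r ⊆ Metric.ball x (2 * r) :=
      Metric.ball_subset_ball' (by rw [dist_comm]; linarith)
    have := essInf_antitone_measure (f := fun y => (f y : EReal))
      (Measure.restrict_mono_set volume hsub).absolutelyContinuous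
    rw [hm', hm1] at this
    exact_mod_cast this
  set A := (campanatoLowerConst ρ β θ f).toReal with hA
  have hA0 : 0 ≤ A := ENNReal.toReal_nonneg
  have hC0 : 0 < C₀ := one_pos.trans_le hC
  have hx0 := hρ x₀
  have hxp := hρ x
  set u := 1 + r / ρ x₀ with hu
  have hu1 : 1 ≤ u := le_add_of_nonneg_right (by positivity)
  have hu0 : 0 < u := one_pos.trans_le hu1
  have hP := pointwiseConst_pos (d := d) hβ
  -- Recentring from `x` to `x₀` uses only the lower half of slow variation: `ρ x₀ / ρ x ≤ C₀ * u ^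
  -- N₀` and `r / ρ x₀ ≤ u`. This is the origin of the exponent `N₀ + 1`.
  have hgrow : 1 + 2 * r / ρ x ≤ 4 * C₀ * u ^ (N₀ + 1) := by
    have h1 := hslow x₀ x
    have h2 : u ^ (-N₀) ≤ (1 + dist x₀ x / ρ x₀) ^ (-N₀) := by
      refine Real.rpow_le_rpow_of_nonpos (by positivity) ?_ (by linarith)
      rw [dist_comm] at hdist
      rw [hu]
      gcongr
    have h3 : 1 / C₀ * u ^ (-N₀) ≤ ρ x / ρ x₀ := le_trans (by gcongr) h1
    rw [Real.rpow_neg hu0.le, one_div, ← mul_inv, inv_le_comm₀ (by positivity) (by positivity),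
      inv_div] at h3
    have h4 : r / ρ x ≤ C₀ * u ^ (N₀ + 1) := by
      calc r / ρ x = (r / ρ x₀) * (ρ x₀ / ρ x) := by field_simp
        _ ≤ u * (C₀ * u ^ N₀) := by
          gcongr
          linarith
        _ = C₀ * u ^ (N₀ + 1) := by
          rw [Real.rpow_add hu0, Real.rpow_one]
          ring
    have h5 : 1 ≤ C₀ * u ^ (N₀ + 1) :=
      one_le_mul_of_one_le_of_one_le hC (Real.one_le_rpow hu1 (by linarith))
    rw [mul_div_assoc]
    linarith
  have hkey : f x - m ≤ pointwiseConst d β * (4 * C₀) ^ θ * 2 ^ β * A * u ^ ((N₀ + 1) * θ) *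
      volume.real (Metric.ball x₀ r) ^ (β / (d : ℝ)) := by
    calc f x - m ≤ f x - m' := by linarith
      _ ≤ _ := hle
      _ ≤ pointwiseConst d β * (A * (4 * C₀ * u ^ (N₀ + 1)) ^ θ *
          volume.real (Metric.ball x (2 * r)) ^ (β / (d : ℝ))) := by gcongr
      _ = _ := by
        rw [volume_real_ball_rpow hd x hR, volume_real_ball_rpow hd x₀ hr,
          Real.mul_rpow (by positivity) (by positivity), Real.mul_rpow (by norm_num) hr.le,
          ← Real.rpow_mul hu0.le]
        ring
  rw [hm3]
  refine (ENNReal.ofReal_le_ofReal hkey).trans (le_of_eq ?_)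
  rw [ENNReal.ofReal_mul (by positivity), ENNReal.ofReal_mul (by positivity),
    ENNReal.ofReal_mul (by positivity), hA, ENNReal.ofReal_toReal h.2.ne, measureReal_def,
    ENNReal.toReal_rpow, ENNReal.ofReal_toReal (ENNReal.rpow_ne_top_of_nonneg (by positivity)
      measure_ball_lt_top.ne)]
  rfl

/-- A constant leaves the weighted mean whatever the weight: `M⁻¹ * M ≤ 1` holds even for `M = 0` or
`M = ∞`. -/
theorem weightedOsc_le_of_ae_le (hq : 0 < q) (x₀ : EuclideanSpace ℝ (Fin d)) (hr : 0 < r)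
    {K : ℝ≥0∞} (hω : AEMeasurable ω volume)
    (h : ∀ᵐ x ∂volume.restrict (Metric.ball x₀ r),
      lowerOsc f x₀ r x ≤ K * volume (Metric.ball x₀ r) ^ (β / (d : ℝ))) :
    weightedOsc ω q β f x₀ r ≤ K := by
  set T := volume (Metric.ball x₀ r) ^ (β / (d : ℝ)) with hT
  have hT0 : T ≠ 0 := by
    rw [hT, Ne, ENNReal.rpow_eq_zero_iff]
    simp [volume_ball_ne_zero x₀ hr, measure_ball_lt_top.ne]
  have hTt : T ≠ ∞ :=
    ENNReal.rpow_ne_top_of_ne_zero (volume_ball_ne_zero x₀ hr) measure_ball_lt_top.ne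
  set M := weightMass ω q (Metric.ball x₀ r) with hM
  have h1 : ∫⁻ x in Metric.ball x₀ r, lowerOsc f x₀ r x ^ q * ENNReal.ofReal (ω x) ^ q ≤
      (K * T) ^ q * M := by
    rw [hM, weightMass, ← lintegral_const_mul'' _ (hω.ennreal_ofReal.pow_const _).restrict]
    refine lintegral_mono_ae ?_
    filter_upwards [h] with x hx
    gcongr
  calc weightedOsc ω q β f x₀ r ≤ T⁻¹ * (M⁻¹ * ((K * T) ^ q * M)) ^ (1 / q) := by
        unfold weightedOsc
        gcongr
    _ = T⁻¹ * ((M⁻¹ * M) * (K * T) ^ q) ^ (1 / q) := by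
        congr 2
        ring
    _ ≤ T⁻¹ * (1 * (K * T) ^ q) ^ (1 / q) := by
        gcongr
        exact ENNReal.inv_mul_le_one M
    _ = K := by
        rw [one_mul, ← ENNReal.rpow_mul, mul_one_div_cancel hq.ne', ENNReal.rpow_one,
          mul_comm K, ← mul_assoc, ENNReal.inv_mul_cancel hT0 hTt, one_mul]
end

/-! ### Assembly of the theorem. -/

theorem mainTheorem5 (d : ℕ) (hd : 3 ≤ d)
    (V : EuclideanSpace ℝ (Fin d) → ℝ) (hV_nonneg : ∀ x, 0 ≤ V x)
    (hV_loc : LocallyIntegrable V volume) (hV_ne : ¬ V =ᵐ[volume] 0)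
    (s : ℝ≥0∞) (hs : (d : ℝ≥0∞) / 2 ≤ s) (hV_rh : ReverseHolder V s)
    (p q θ₁ θ₂ β : ℝ) (hp : 1 ≤ p) (hpq : p < q) (hθ₁ : 0 < θ₁) (hθ₂ : 0 < θ₂)
    (hβ_pos : 0 < β) (hβ_lt : β < 1) :
    (∃ N₀ : ℝ, IsSlowVariationExponent (criticalRadius V) N₀) ∧
    (∀ N₀ : ℝ, IsSlowVariationExponent (criticalRadius V) N₀ →
      ∃ C : ℝ, 0 < C ∧
        ∀ ω : EuclideanSpace ℝ (Fin d) → ℝ, MemApq (criticalRadius V) p q θ₂ ω →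
        ∀ f : EuclideanSpace ℝ (Fin d) → ℝ, MemCampanatoLower (criticalRadius V) β θ₁ f →
        ∀ (x₀ : EuclideanSpace ℝ (Fin d)) (r : ℝ), 0 < r →
          weightedOsc ω q β f x₀ r ≤
            ENNReal.ofReal C * apqConst (criticalRadius V) p q θ₂ ω *
              growthFactor (criticalRadius V) x₀ r ((N₀ + 1) * θ₁) *
                campanatoLowerConst (criticalRadius V) β θ₁ f) ∧
    (∀ ω : EuclideanSpace ℝ (Fin d) → ℝ, MemApq (criticalRadius V) p q θ₂ ω →
      ∀ f : EuclideanSpace ℝ (Fin d) → ℝ, AEMeasurable f volume →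
      ∀ C : ℝ, 0 < C →
        (∀ (x₀ : EuclideanSpace ℝ (Fin d)) (r : ℝ), 0 < r →
          weightedOsc ω q β f x₀ r ≤
            ENNReal.ofReal C * apqConst (criticalRadius V) p q θ₂ ω *
              growthFactor (criticalRadius V) x₀ r (θ₁ - θ₂)) →
        MemCampanatoLower (criticalRadius V) β θ₁ f ∧
          campanatoLowerConst (criticalRadius V) β θ₁ f ≤
            ENNReal.ofReal C * apqConst (criticalRadius V) p q θ₂ ω ^ 2) := by
  obtain ⟨hρ, hN⟩ := hV_rh.criticalRadius_pos_and_slowVariation hd hV_nonneg hV_loc hs hV_ne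
  have hq0 : 0 < q := one_pos.trans_le (hp.trans hpq.le)
  refine ⟨hN, ?_, ?_⟩
  · rintro N₀ ⟨hN₀, C₀, hC₀, hslow⟩
    have hP := pointwiseConst_pos (d := d) hβ_pos
    refine ⟨pointwiseConst d β * (4 * C₀) ^ θ₁ * 2 ^ β, by positivity, ?_⟩
    intro ω hω f hf x₀ r hr
    have h1 := weightedOsc_le_of_ae_le hq0 x₀ hr
      hω.1.locallyIntegrable.aestronglyMeasurable.aemeasurable
      (hf.ae_lowerOsc_le hd hρ hβ_pos hθ₁.le hN₀.le hC₀ (fun x y => (hslow x y).1) x₀ hr)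
    refine h1.trans ?_
    calc _ = ENNReal.ofReal (pointwiseConst d β * (4 * C₀) ^ θ₁ * 2 ^ β) * 1 *
          growthFactor (criticalRadius V) x₀ r ((N₀ + 1) * θ₁) *
            campanatoLowerConst (criticalRadius V) β θ₁ f := by ring
      _ ≤ _ := by
        gcongr
        exact hω.one_le_apqConst hρ hp hpq.le
  · intro ω hω f hf C _ hosc
    have hle := hω.campanatoLowerConst_le hρ hp hpq.le hf hosc
    refine ⟨?_, hle⟩
    have hfin : campanatoLowerConst (criticalRadius V) β θ₁ f < ∞ :=
      hle.trans_lt (ENNReal.mul_lt_top ENNReal.ofReal_lt_top (ENNReal.pow_lt_top hω.2))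
    exact ⟨locallyIntegrable_of_campanatoLowerConst_lt_top hρ hf hfin, hfin⟩
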